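/- Let $\lambda>0$ be real, let $\Omega$ be an alphabet of $b\ge 2$ symbols, and let $(p_i)_{i\ge 0}$ be non-negative reals with $\sum_{i\ge 0}p_i=1$ and $\sum_{i\ge 0} i\,p_i=\lambda$; if $b=2$, assume also $p_0\ge 1/2$. For a sequence $x$ over $\Omega$, $i\ge 0$ and $k\ge 1$, let $Z^{\lambda}_{i,k}(x)$ be the proportion, among the $b^k$ words of length $k$, of those that occur exactly $i$ times in $x[1\ldots\lfloor\lambda b^k\rfloor+k-1]$. A *cyclic de Bruijn word of order $n$* is a word of length $b^n$ in which, read circularly, every word of length $n$ occurs exactly once. An *infinite de Bruijn sequence* is a sequence $A$ over $\Omega$ such that, for every $k\ge1$, $A[1\ldots b^k]$ is a cyclic de Bruijn word of order $k$ if $b\ge 3$, and $A[1\ldots 2^{2k-1}]$ is a cyclic de Bruijn word of order $2k-1$ if $b=2$. *Construction from $A$ and $(p_i)$.* For $y\in[0,1]$, digits are those of the base-$b$ expansion of $y$ not ending in a tail of $(b-1)$'s, except that $1=0.(b-1)(b-1)\ldots$. Let $g(k)=\lceil k/2\rceil$, $y_{1,i}=p_i$, and $y_{k,i}=\frac{b-1}{b}p_i$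 for $k\ge 2$. In step $k\ge 1$, for all $i\ge 1$ and $1\le j\le g(k)$, select as many blocks (segments) of length $b^{k-j}$ in $A[1\ldots b^k]$ as the $j$-th digit of $y_{k,i}$ says. All blocks selected in all steps must be pairwise non-overlapping; moreover, after step $1$, and after every step if $b=2$, the blocks selected so far must fill an initial segment of $A$ without gaps. Then append to the output, in any order, the blocks selected in step $k$, each of those belonging to $i$ written $i$ times consecutively. The result is the infinite sequence $x$ that has all these finite outputs, whose lengths tend to infinity, as initial segments. Then an infinite de Bruijn sequence over $\Omega$ exists; from every infinite de Bruijn sequence $A$ over $\Omega$ the construction can be carried out and produces an infinite sequence $x$; and every sequence $x$ that it produces (whatever the choices made) satisfies $$\lim_{k\to\infty} Z^{\lambda}_{i,k}(x)=p_i\qquad\text{for every } i\ge 0 .$$ In particular there is a sequence $x\in\Omega^{\mathbb N}$ with these limits. -/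

import Mathlib

open Filter Topology

namespace PoissonGeneric

/-! ### Words and occurrences

Words over the alphabet `Ω` are lists; an infinite sequence is a function `x : ℕ → Ω`, the symbol in
position `n + 1` being `x n` (so positions are counted from `0` here). -/

/-- The word of length `len` that starts after the first `s` symbols of the sequence `x`,
that is, `x[s+1 ... s+len]`. -/
def factor {Ω : Type*} (x : ℕ → Ω) (s len : ℕ) : List Ω :=
  (List.range len).map fun m => x (s + m)

/-- The initial segment `x[1 ... N]` of the sequence `x`. -/
def initSeg {Ω : Type*} (x : ℕ → Ω) (N : ℕ) : List Ω :=
  factor x 0 N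

/-- The number of (possibly overlapping) occurrences of the word `w` in the word `v`. -/
def occ {Ω : Type*} [DecidableEq Ω] (v w : List Ω) : ℕ :=
  ((Finset.range (v.length + 1)).filter fun s =>
    s + w.length ≤ v.length ∧ (v.drop s).take w.length = w).card

/-- `Z^lam_{i,k}(x)`: the proportion of words of length `k` which occur exactly `i` times in
`x[1 ... ⌊lam b^k⌋ + k - 1]`, where `b` is the size of the alphabet. -/
noncomputable def Z {Ω : Type*} [Fintype Ω] [DecidableEq Ω]
    (lam : ℝ) (i k : ℕ) (x : ℕ → Ω) : ℝ :=
  ((Finset.univ.filter fun w : Fin k → Ω =>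
      occ (initSeg x (⌊lam * (Fintype.card Ω : ℝ) ^ k⌋₊ + k - 1)) (List.ofFn w) = i).card : ℝ)
    / (Fintype.card Ω : ℝ) ^ k

/-! ### De Bruijn words and infinite de Bruijn sequences -/

/-- `w` is a cyclic de Bruijn word of order `n`: its length is `b^n` and every word of length `n`
occurs exactly once in the circular word determined by `w`. -/
def IsCyclicDeBruijn {Ω : Type*} [Fintype Ω] (n : ℕ) (w : List Ω) : Prop :=
  w.length = Fintype.card Ω ^ n ∧
    ∀ u : List Ω, u.length = n → ∃! s : ℕ, s < w.length ∧ (w.rotate s).take n = u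

/-- Infinite de Bruijn sequences: over at least three symbols every initial segment of length `b^k`
is a cyclic de Bruijn word of order `k`; over two symbols this is asked for odd orders. -/
def IsInfiniteDeBruijn {Ω : Type*} [Fintype Ω] (A : ℕ → Ω) : Prop :=
  (3 ≤ Fintype.card Ω → ∀ k : ℕ, 1 ≤ k →
    IsCyclicDeBruijn k (initSeg A (Fintype.card Ω ^ k))) ∧
  (Fintype.card Ω = 2 → ∀ k : ℕ, 1 ≤ k →
    IsCyclicDeBruijn (2 * k - 1) (initSeg A (2 ^ (2 * k - 1))))

/-! ### The construction -/

/-- The `j`-th digit after the point (`j ≥ 1`) of the base-`b` expansion of `y ∈ [0, 1]`. For `y < 1`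
it is the expansion without a tail of digits `b - 1`; for `y = 1` it is `0.(b-1)(b-1)(b-1)...`. -/
noncomputable def digit (b : ℕ) (y : ℝ) (j : ℕ) : ℕ :=
  if y = 1 then b - 1 else ⌊y * (b : ℝ) ^ j⌋₊ % b

/-- The number of digits that are used in step `k`, namely `⌈k / 2⌉`. -/
def g (k : ℕ) : ℕ := (k + 1) / 2

/-- The number whose expansion is used in step `k` for the multiplicity `i`:
`p_i` in the first step and `((b - 1) / b) p_i` in all later ones. -/
noncomputable def stepNumber (b : ℕ) (p : ℕ → ℝ) (k i : ℕ) : ℝ :=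
  if k = 1 then p i else (((b : ℝ) - 1) / (b : ℝ)) * p i

/-- A selected block: it begins after the first `start` symbols of `A`; if it is selected in step `k`
its relative length with respect to `A[1 ... b^k]` is `b^(-level)`; and it is written `mult` times. -/
structure Block where
  start : ℕ
  level : ℕ
  mult : ℕ

/-- The absolute length of a block selected in step `k`. -/
def Block.len (b k : ℕ) (β : Block) : ℕ := b ^ (k - β.level)

/-- The set of positions of `A` (counted from `0`) covered by a block selected in step `k`. -/
def Block.positions (b k : ℕ) (β : Block) : Finset ℕ :=
  Finset.Ico β.start (β.start + β.len b k)

/-- The run segment of a block selected in step `k`: the concatenation of `mult` copies of it. -/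
def Block.run {Ω : Type*} (A : ℕ → Ω) (b k : ℕ) (β : Block) : List Ω :=
  (List.replicate β.mult (factor A β.start (β.len b k))).flatten

/-- `S k` lists, for every `k ≥ 1`, the blocks selected in step `k` of the construction, in the order
in which their run segments are appended to the output (any order is allowed). -/
structure IsSelection (b : ℕ) (p : ℕ → ℝ) (S : ℕ → List Block) : Prop where
  /-- For all `i ≥ 1` and `1 ≤ j ≤ g k`, the number of blocks of relative length `b^(-j)` that are
  selected for the multiplicity `i` is the `j`-th digit of the number belonging to `k` and `i`;
  no other blocks are selected. -/
  count : ∀ k, 1 ≤ k → ∀ i j : ℕ,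
    (S k).countP (fun β => decide (β.mult = i ∧ β.level = j)) =
      if 1 ≤ i ∧ 1 ≤ j ∧ j ≤ g k then digit b (stepNumber b p k i) j else 0
  /-- The blocks of step `k` are blocks in `A[1 ... b^k]`. -/
  inside : ∀ k, 1 ≤ k → ∀ β ∈ S k, β.start + β.len b k ≤ b ^ k
  /-- Blocks selected in the same step do not overlap. -/
  disjoint_same : ∀ k, 1 ≤ k →
    (S k).Pairwise fun β γ => Disjoint (β.positions b k) (γ.positions b k)
  /-- Blocks selected in different steps do not overlap. -/
  disjoint_diff : ∀ k l, 1 ≤ k → 1 ≤ l → k ≠ l → ∀ β ∈ S k, ∀ γ ∈ S l,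
    Disjoint (β.positions b k) (γ.positions b l)
  /-- In the first step, and in all steps when `b = 2`, no gaps are left: the blocks selected so far
  fill an initial segment of `A`. -/
  no_gap : ∀ k, 1 ≤ k → (k = 1 ∨ b = 2) → ∃ n : ℕ, ∀ m : ℕ,
    m < n ↔ ∃ l, 1 ≤ l ∧ l ≤ k ∧ ∃ β ∈ S l, m ∈ β.positions b l

/-- The finite word `x_k` that is the output after step `k`. -/
def output {Ω : Type*} (A : ℕ → Ω) (b : ℕ) (S : ℕ → List Block) : ℕ → List Ω
  | 0 => []
  | k + 1 => output A b S k ++ (S (k + 1)).flatMap fun β => β.run A b (k + 1)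

/-- `x` is an infinite word that the construction produces from the sequence `A` and the numbers
`p_i`: for an admissible selection of blocks, the output words get arbitrarily long and all of them
are initial segments of `x`. -/
def IsConstructed {Ω : Type*} [Fintype Ω] (p : ℕ → ℝ) (A x : ℕ → Ω) : Prop :=
  ∃ S : ℕ → List Block, IsSelection (Fintype.card Ω) p S ∧
    Tendsto (fun k => (output A (Fintype.card Ω) S k).length) atTop atTop ∧
    ∀ k, output A (Fintype.card Ω) S k =
      initSeg x (output A (Fintype.card Ω) S k).length

end PoissonGeneric

/-! # Sequences with prescribed limiting frequencies of multiplicities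

*Infinite de Bruijn sequences.* A cyclic de Bruijn word of order `n` is a cycle in the de Bruijn
graph whose vertices are the words of length `m` and whose edges are those of length `m + 1`,
where `m ≥ n`. It passes every vertex at most once, so the remaining graph is balanced. For a word
`v` of length `m - 1`, the edges `c v d` form a complete bipartite graph, from which the cycle
removes a partial matching; for `m = n` and at least three symbols, or for `m > n`, what is left
of it is connected, and so is the remaining graph (`residual_connected`). An Eulerian circuit of
it (`exists_eulerian_circuit`), appended to the cycle, gives a de Bruijn word of order `m + 1`
that extends the given one (`IsPeriodicDeBruijn.exists_extension`). Thus orders can be increased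
one by one over at least three symbols, and two by two over any alphabet.

*Carrying out the construction.* Truncating an expansion does not increase a number, so the blocks
selected up to step `k` for the multiplicity `i` have total length at most `p i * b ^ k`
(`selectedLength_le`). Hence all blocks can be placed one after the other, without gaps
(`exists_isSelection`), and the output of step `k` has length at most `lam * b ^ k`
(`length_output_le`).

*The limits.* The truncation errors and the positions close to the end of a block are negligible,
so about `p i * b ^ k` positions start a word of length `k` inside a block of multiplicity `i`
(`tendsto_card_startSet_div`). These words are pairwise distinct by the de Bruijn property
(`eq_of_factor_eq`), and each of them occurs at least `i` times in the output. Since `∑ i, i * p i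
= lam`, this accounts already for almost all of the at most `lam * b ^ k` occurrences of words of
length `k`; so, up to a negligible number of exceptions, these words occur exactly `i` times, and
all other words do not occur (`abs_card_sub_le_excess`, `tendsto_Z`).
-/

namespace PoissonGeneric

/-! ### Eulerian circuits -/

/-- In a finite directed graph with edge set `E`, a permutation `σ` of the edges such that `σ e`
starts where `e` ends is a decomposition into closed trails. If the graph is connected, such a
permutation can be chosen with only one cycle, which is then an Eulerian circuit. -/
theorem exists_perm_sameCycle {E V : Type*} [Finite E] (src tgt : E → V) (e₀ : E)
    (σ₀ : Equiv.Perm E) (h₀ : ∀ e, src (σ₀ e) = tgt e)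
    (hconn : ∀ C : Set E, C.Nonempty → (∀ e ∈ C, ∀ e', tgt e' = tgt e → e' ∈ C) →
      (∀ e ∈ C, ∀ e', src e' = src e → e' ∈ C) → (∀ e ∈ C, ∀ e', src e' = tgt e → e' ∈ C) →
      C = Set.univ) :
    ∃ σ : Equiv.Perm E, (∀ e, src (σ e) = tgt e) ∧ ∀ e, σ.SameCycle e₀ e := by
  classical
  have : Nonempty {σ : Equiv.Perm E // ∀ e, src (σ e) = tgt e} := ⟨⟨σ₀, h₀⟩⟩
  obtain ⟨⟨σ, hσ⟩, hmax⟩ := Finite.exists_max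
    (fun σ : {σ : Equiv.Perm E // ∀ e, src (σ e) = tgt e} => {e | σ.1.SameCycle e₀ e}.ncard)
  refine ⟨σ, hσ, ?_⟩
  -- A second cycle through an endpoint of an edge of the cycle of `e₀` could be spliced into it.
  have htgt : ∀ e ∈ {e | σ.SameCycle e₀ e}, ∀ e', tgt e' = tgt e →
      e' ∈ {e | σ.SameCycle e₀ e} := by
    intro e he e' hee'
    by_contra hne
    change σ.SameCycle e₀ e at he
    change ¬ σ.SameCycle e₀ e' at hne
    have hne' : ¬ σ.SameCycle e' e := fun h => hne (he.trans h.symm)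
    set τ : Equiv.Perm E := σ * Equiv.swap e e' with hτ
    have hτe : τ e = σ e' := by simp [hτ]
    have hτe' : τ e' = σ e := by simp [hτ]
    have hτz : ∀ z, z ≠ e → z ≠ e' → τ z = σ z := fun z h1 h2 => by
      simp [hτ, Equiv.swap_apply_of_ne_of_ne h1 h2]
    have hτv : ∀ z, src (τ z) = tgt z := by
      intro z
      by_cases h1 : z = e
      · rw [h1, hτe, hσ, hee']
      by_cases h2 : z = e'
      · rw [h2, hτe', hσ, hee']
      rw [hτz z h1 h2, hσ]
    have hmem : τ.SameCycle e e' := by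
      by_contra hno
      have key : ∀ t : ℕ, τ.SameCycle e ((σ ^ (t + 1)) e') := by
        intro t
        induction t with
        | zero => rw [zero_add, pow_one, ← hτe]; exact Equiv.Perm.sameCycle_apply_right.2 .rfl
        | succ t ih =>
          have h1 : (σ ^ (t + 1)) e' ≠ e :=
            fun h => hne' ⟨(t + 1 : ℕ), by rw [zpow_natCast]; exact h⟩
          have h2 : (σ ^ (t + 1)) e' ≠ e' := fun h => hno (h ▸ ih)
          rw [pow_succ', Equiv.Perm.mul_apply, ← hτz _ h1 h2]
          exact Equiv.Perm.sameCycle_apply_right.2 ih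
      have := Fintype.ofFinite E
      have hpos := orderOf_pos σ
      have := key (orderOf σ - 1)
      rw [Nat.sub_add_cancel hpos, pow_orderOf_eq_one] at this
      exact hno this
    have hstep : ∀ z, τ.SameCycle e z → τ.SameCycle e (σ z) := by
      intro z hz
      by_cases h1 : z = e
      · rw [h1, ← hτe']; exact Equiv.Perm.sameCycle_apply_right.2 hmem
      by_cases h2 : z = e'
      · rw [h2, ← hτe]; exact Equiv.Perm.sameCycle_apply_right.2 .rfl
      rw [← hτz z h1 h2]; exact Equiv.Perm.sameCycle_apply_right.2 hz
    have hsub : ∀ z, σ.SameCycle e z → τ.SameCycle e z := by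
      intro z hz
      obtain ⟨n, rfl⟩ := hz.exists_nat_pow_eq
      clear hz
      induction n with
      | zero => exact .rfl
      | succ n ih => rw [pow_succ', Equiv.Perm.mul_apply]; exact hstep _ ih
    have he0 : τ.SameCycle e₀ e := (hsub _ he.symm).symm
    have hlt : {z | σ.SameCycle e₀ z}.ncard < {z | τ.SameCycle e₀ z}.ncard := by
      apply Set.ncard_lt_ncard _ (Set.toFinite _)
      refine Set.ssubset_iff_of_subset ?_ |>.2 ⟨e', he0.trans hmem, hne⟩
      intro z hz
      exact he0.trans (hsub z (he.symm.trans hz))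
    exact absurd (hmax ⟨τ, hτv⟩) (not_le.2 hlt)
  have hinv : ∀ e, tgt (σ.symm e) = src e := fun e => by rw [← hσ, Equiv.apply_symm_apply]
  have hC := hconn {e | σ.SameCycle e₀ e} ⟨e₀, .rfl⟩ htgt ?_ ?_
  · intro e
    have : e ∈ {e | σ.SameCycle e₀ e} := hC ▸ Set.mem_univ e
    exact this
  · intro e he e' hee'
    have h1 : σ.SameCycle e₀ (σ.symm e) := by
      rw [← Equiv.Perm.sameCycle_apply_right, Equiv.apply_symm_apply]; exact he
    have := htgt (σ.symm e) h1 (σ.symm e') (by rw [hinv, hinv, hee'])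
    have h2 := Equiv.Perm.sameCycle_apply_right.2 this
    rwa [Equiv.apply_symm_apply] at h2
  · intro e he e' hee'
    have := htgt e he (σ.symm e') (by rw [hinv, hee'])
    have h2 := Equiv.Perm.sameCycle_apply_right.2 this
    rwa [Equiv.apply_symm_apply] at h2

/-- A connected finite directed graph in which every vertex has as many incoming as outgoing edges
has an Eulerian circuit, here given as a periodic sequence of edges. -/
theorem exists_eulerian_circuit {E V : Type*} [Fintype E] [DecidableEq V] (src tgt : E → V) (e₀ : E)
    (hbal : ∀ v, Fintype.card {e // tgt e = v} = Fintype.card {e // src e = v})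
    (hconn : ∀ C : Set E, C.Nonempty → (∀ e ∈ C, ∀ e', tgt e' = tgt e → e' ∈ C) →
      (∀ e ∈ C, ∀ e', src e' = src e → e' ∈ C) → (∀ e ∈ C, ∀ e', src e' = tgt e → e' ∈ C) →
      C = Set.univ) :
    ∃ c : ℕ → E, c 0 = e₀ ∧ c (Fintype.card E) = e₀ ∧ (∀ t, src (c (t + 1)) = tgt (c t)) ∧
      ∀ e, ∃ t < Fintype.card E, c t = e := by
  classical
  let σ₀ : Equiv.Perm E := (Equiv.sigmaFiberEquiv tgt).symm.trans
    ((Equiv.sigmaCongrRight fun v => Fintype.equivOfCardEq (hbal v)).trans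
      (Equiv.sigmaFiberEquiv src))
  have h₀ : ∀ e, src (σ₀ e) = tgt e := fun e =>
    (Fintype.equivOfCardEq (hbal (tgt e)) ⟨e, rfl⟩).2
  obtain ⟨σ, hσ, hcyc⟩ := exists_perm_sameCycle src tgt e₀ σ₀ h₀ hconn
  have hon : σ.IsCycleOn (Finset.univ : Finset E) :=
    ⟨by simp, fun x _ y _ => (hcyc x).symm.trans (hcyc y)⟩
  refine ⟨fun t => (σ ^ t) e₀, rfl, ?_, fun t => ?_, fun e => ?_⟩
  · exact (hon.pow_apply_eq (Finset.mem_univ e₀)).2 (by simp)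
  · simp only [pow_succ', Equiv.Perm.mul_apply, hσ]
  · obtain ⟨n, hn, h⟩ := hon.exists_pow_eq (Finset.mem_univ e₀) (Finset.mem_univ e)
    exact ⟨n, by simpa using hn, h⟩

/-! ### Extending cyclic de Bruijn words -/

/-- The word of length `n` that occurs in `f` after the first `s` symbols, as a tuple. -/
def window {Ω : Type*} (n : ℕ) (f : ℕ → Ω) (s : ℕ) : Fin n → Ω := fun i => f (s + i)

theorem init_window {Ω : Type*} (n : ℕ) (f : ℕ → Ω) (s : ℕ) :
    Fin.init (window (n + 1) f s) = window n f s := rfl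

theorem tail_window {Ω : Type*} (n : ℕ) (f : ℕ → Ω) (s : ℕ) :
    Fin.tail (window (n + 1) f s) = window n f (s + 1) := by
  funext i
  simp only [Fin.tail, window, Fin.val_succ]
  congr 1; omega

theorem window_mod {Ω : Type*} {N : ℕ} {f : ℕ → Ω} (hf : Function.Periodic f N) (n s : ℕ) :
    window n f (s % N) = window n f s := by
  funext i
  simp only [window]
  rw [← hf.map_mod_nat (s % N + i), ← hf.map_mod_nat (s + i)]
  simp

/-- The word `c v d`: an edge of the de Bruijn graph from the vertex `c v` to the vertex `v d`. -/
def bridge {Ω : Type*} {r : ℕ} (c : Ω) (v : Fin r → Ω) (d : Ω) : Fin (r + 2) → Ω :=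
  Fin.cons (α := fun _ => Ω) c (Fin.snoc (α := fun _ => Ω) v d)

theorem tail_bridge {Ω : Type*} {r : ℕ} (c : Ω) (v : Fin r → Ω) (d : Ω) :
    Fin.tail (bridge c v d) = Fin.snoc (α := fun _ => Ω) v d := Fin.tail_cons _ _

theorem init_bridge {Ω : Type*} {r : ℕ} (c : Ω) (v : Fin r → Ω) (d : Ω) :
    Fin.init (bridge c v d) = Fin.cons (α := fun _ => Ω) c v := by
  unfold bridge
  rw [Fin.cons_snoc_eq_snoc_cons, Fin.init_snoc]

theorem bridge_self {Ω : Type*} {r : ℕ} (e : Fin (r + 2) → Ω) :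
    bridge (e 0) (Fin.init (Fin.tail e)) (e (Fin.last _)) = e := by
  unfold bridge
  have : (e (Fin.last (r + 1))) = Fin.tail e (Fin.last r) := rfl
  rw [this, Fin.snoc_init_self, Fin.cons_self_tail]

theorem bridge_left_injective {Ω : Type*} {r : ℕ} {c c' : Ω} {v : Fin r → Ω} {d d' : Ω}
    (h : bridge c v d = bridge c' v d') : c = c' := congrFun h 0

theorem bridge_right_injective {Ω : Type*} {r : ℕ} {c c' : Ω} {v : Fin r → Ω} {d d' : Ω}
    (h : bridge c v d = bridge c' v d') : d = d' := by
  have := congrArg Fin.tail h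
  rw [tail_bridge, tail_bridge] at this
  have h2 := congrFun this (Fin.last r)
  simpa using h2

/-- Every word of length `r + 1` is reached from every other one by repeatedly deleting the first
symbol and adding a symbol at the end. -/
theorem mem_of_shift_closed {Ω : Type*} {r : ℕ} (X : Set (Fin (r + 1) → Ω)) (hX : X.Nonempty)
    (hshift : ∀ u ∈ X, ∀ d, Fin.snoc (α := fun _ => Ω) (Fin.tail u) d ∈ X) (v : Fin (r + 1) → Ω) :
    v ∈ X := by
  obtain ⟨u, hu⟩ := hX
  let f : ℕ → Ω := fun n => if h : n < r + 1 then u ⟨n, h⟩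
    else v ⟨(n - (r + 1)) % (r + 1), Nat.mod_lt _ (Nat.succ_pos r)⟩
  have key : ∀ t, window (r + 1) f t ∈ X := by
    intro t
    induction t with
    | zero =>
      convert hu using 1
      funext i
      simp only [window, f, zero_add, dif_pos i.isLt]
    | succ t ih =>
      convert hshift _ ih (f (t + (r + 1))) using 1
      rw [tail_window]
      conv_lhs => rw [← Fin.snoc_init_self (window (r + 1) f (t + 1)), init_window]
      congr 1
      simp only [window, Fin.val_last]
      congr 1; omega
  convert key (r + 1) using 1
  funext i
  have hi : ¬ r + 1 + (i : ℕ) < r + 1 := by omega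
  simp only [window, f, hi, dif_neg, not_false_eq_true]
  congr 1
  simp [Nat.mod_eq_of_lt i.isLt]

/-- The graph that is left of the de Bruijn graph on the words of length `r + 1` after deleting the
edges `H` of a cycle is connected. For every word `v` of length `r`, the edges `c v d` form a
complete bipartite graph between the vertices `c v` and the vertices `v d`, of which a
partial matching has been deleted; it stays connected if there are at least three symbols, or if at
most one edge has been deleted. -/
theorem residual_connected {Ω : Type*} [Fintype Ω] {r : ℕ} (hb : 2 ≤ Fintype.card Ω)
    (H : Set (Fin (r + 2) → Ω))
    (hsrc : ∀ e ∈ H, ∀ e' ∈ H, Fin.init e = Fin.init e' → e = e')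
    (htgt : ∀ e ∈ H, ∀ e' ∈ H, Fin.tail e = Fin.tail e' → e = e')
    (hbig : 3 ≤ Fintype.card Ω ∨
      ∀ e ∈ H, ∀ e' ∈ H, Fin.init (Fin.tail e) = Fin.init (Fin.tail e') → e = e')
    (C : Set {e // e ∉ H}) (hC : C.Nonempty)
    (h1 : ∀ e ∈ C, ∀ e' : {e // e ∉ H}, Fin.tail e'.1 = Fin.tail e.1 → e' ∈ C)
    (h2 : ∀ e ∈ C, ∀ e' : {e // e ∉ H}, Fin.init e'.1 = Fin.init e.1 → e' ∈ C)
    (h3 : ∀ e ∈ C, ∀ e' : {e // e ∉ H}, Fin.init e'.1 = Fin.tail e.1 → e' ∈ C) :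
    C = Set.univ := by
  classical
  obtain ⟨a, a', haa'⟩ := Fintype.one_lt_card_iff.1 (show 1 < Fintype.card Ω by omega)
  have hin : ∀ (v : Fin r → Ω) (d : Ω), ∃ c, bridge c v d ∉ H := by
    intro v d
    by_contra! hno
    refine haa' (bridge_left_injective (htgt _ (hno a) _ (hno a') ?_))
    rw [tail_bridge, tail_bridge]
  have hout : ∀ u : Fin (r + 1) → Ω, ∃ e : {e // e ∉ H}, Fin.init e.1 = u := by
    intro u
    have hu : ∀ d, Fin.init (bridge (u 0) (Fin.tail u) d) = u := fun d => by
      rw [init_bridge, Fin.cons_self_tail]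
    by_contra! hno
    have hmem : ∀ d, bridge (u 0) (Fin.tail u) d ∈ H := fun d => by
      by_contra h
      exact hno ⟨_, h⟩ (hu d)
    refine haa' (bridge_right_injective (hsrc _ (hmem a) _ (hmem a') ?_))
    rw [hu, hu]
  have hlink : ∀ (v : Fin r → Ω) (c d c' d' : Ω), bridge c v d ∉ H → bridge c' v d' ∉ H →
      bridge c v d' ∉ H ∨ bridge c' v d ∉ H ∨
        ∃ c'', bridge c'' v d ∉ H ∧ bridge c'' v d' ∉ H := by
    intro v c d c' d' hcd hcd'
    by_contra! hno
    obtain ⟨hA, hB, hD⟩ := hno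
    rcases hbig with hbig | hbig
    · obtain ⟨c'', hc''⟩ : ∃ c'', c'' ∉ ({c, c'} : Finset Ω) := by
        by_contra! hall
        have h4 : Fintype.card Ω ≤ ({c, c'} : Finset Ω).card :=
          Finset.card_le_card fun x _ => hall x
        have := Finset.card_le_two (a := c) (b := c')
        omega
      simp only [Finset.mem_insert, Finset.mem_singleton, not_or] at hc''
      have hD1 : bridge c'' v d ∉ H := fun h =>
        hc''.2 (bridge_left_injective (htgt _ h _ hB (by rw [tail_bridge, tail_bridge])))
      refine hc''.1 (bridge_left_injective
        (htgt _ (hD c'' hD1) _ hA (by rw [tail_bridge, tail_bridge])))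
    · have heq := hbig _ hA _ hB
        (by rw [tail_bridge, tail_bridge, Fin.init_snoc, Fin.init_snoc])
      have := bridge_left_injective heq
      subst this
      exact hcd' hA
  have hpiece : ∀ (v : Fin r → Ω) (c d c' d' : Ω) (h : bridge c v d ∉ H)
      (h' : bridge c' v d' ∉ H), (⟨_, h⟩ : {e // e ∉ H}) ∈ C → (⟨_, h'⟩ : {e // e ∉ H}) ∈ C := by
    intro v c d c' d' h h' hmem
    rcases hlink v c d c' d' h h' with hA | hB | ⟨c'', hD, hD'⟩
    · exact h1 ⟨_, hA⟩ (h2 _ hmem _ (by simp only [init_bridge])) _ (by simp only [tail_bridge])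
    · exact h2 ⟨_, hB⟩ (h1 _ hmem _ (by simp only [tail_bridge])) _ (by simp only [init_bridge])
    · exact h1 ⟨_, hD'⟩ (h2 ⟨_, hD⟩ (h1 _ hmem _ (by simp only [tail_bridge])) _
        (by simp only [init_bridge])) _ (by simp only [tail_bridge])
  have hX : ∀ u : Fin (r + 1) → Ω, u ∈ {u | ∃ e ∈ C, Fin.init e.1 = u} := by
    apply mem_of_shift_closed
    · obtain ⟨e, he⟩ := hC
      exact ⟨_, e, he, rfl⟩
    · rintro _ ⟨⟨e, heH⟩, he, rfl⟩ d
      obtain ⟨c', hc'⟩ := hin (Fin.init (Fin.tail e)) d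
      have hmem : (⟨_, hc'⟩ : {e // e ∉ H}) ∈ C := by
        have hb' := bridge_self e
        exact hpiece _ (e 0) (e (Fin.last _)) _ _ (by rwa [hb']) hc' (by simpa only [hb'] using he)
      obtain ⟨e'', he''⟩ := hout (Fin.snoc (α := fun _ => Ω) (Fin.init (Fin.tail e)) d)
      refine ⟨e'', h3 _ hmem _ ?_, ?_⟩
      · rw [he'', tail_bridge]
      · rw [he'']; rfl
  refine Set.eq_univ_of_forall fun e => ?_
  obtain ⟨e', he', h⟩ := hX (Fin.init e.1)
  exact h2 _ he' _ h.symm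

/-- The periodic sequence `f` repeats a cyclic de Bruijn word of order `n`. -/
structure IsPeriodicDeBruijn {Ω : Type*} [Fintype Ω] (n : ℕ) (f : ℕ → Ω) : Prop where
  periodic : Function.Periodic f (Fintype.card Ω ^ n)
  inj : ∀ s < Fintype.card Ω ^ n, ∀ t < Fintype.card Ω ^ n, window n f s = window n f t → s = t

theorem IsPeriodicDeBruijn.modEq {Ω : Type*} [Fintype Ω] {n : ℕ} {f : ℕ → Ω}
    (hb : 2 ≤ Fintype.card Ω) (hf : IsPeriodicDeBruijn n f) {s t : ℕ}
    (h : ∀ i < n, f (s + i) = f (t + i)) : s ≡ t [MOD Fintype.card Ω ^ n] := by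
  have hN : 0 < Fintype.card Ω ^ n := by positivity
  refine hf.inj _ (Nat.mod_lt _ hN) _ (Nat.mod_lt _ hN) ?_
  rw [window_mod hf.periodic, window_mod hf.periodic]
  funext i
  exact h i i.isLt

theorem IsPeriodicDeBruijn.window_congr {Ω : Type*} [Fintype Ω] {n : ℕ} {f : ℕ → Ω}
    (hf : IsPeriodicDeBruijn n f) {s t : ℕ}
    (h : s ≡ t [MOD Fintype.card Ω ^ n]) (q : ℕ) : window q f s = window q f t := by
  rw [← window_mod hf.periodic q s, h, window_mod hf.periodic]

/-- A cyclic de Bruijn word of order `n` can be extended to one of order `n + 1` if there are at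
least three symbols, and always to one of any order above `n + 1`. The word of order `n` is a
cycle in the de Bruijn graph, and what is left of the graph has an Eulerian circuit. -/
theorem IsPeriodicDeBruijn.exists_extension {Ω : Type*} [Fintype Ω] {n r : ℕ} {f : ℕ → Ω}
    (hb : 2 ≤ Fintype.card Ω) (hf : IsPeriodicDeBruijn n f) (hnr : n ≤ r + 1)
    (hbig : 3 ≤ Fintype.card Ω ∨ n ≤ r) :
    ∃ f' : ℕ → Ω, IsPeriodicDeBruijn (r + 2) f' ∧ ∀ s < Fintype.card Ω ^ n, f' s = f s := by
  classical
  set N := Fintype.card Ω ^ n with hN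
  have hNpos : 0 < N := by positivity
  let H : Finset (Fin (r + 2) → Ω) := (Finset.range N).image (window (r + 2) f)
  have hH' : ∀ e ∈ H, ∃ s, window (r + 2) f s = e := fun e he => by
    obtain ⟨s, -, hs⟩ := Finset.mem_image.1 he
    exact ⟨s, hs⟩
  -- A word of length at least `n` has only one position in the cycle.
  have hpos : ∀ q, n ≤ q → ∀ s t, window q f s = window q f t → s ≡ t [MOD N] :=
    fun q hq s t h => hf.modEq hb fun i hi => congrFun h ⟨i, hi.trans_le hq⟩
  have hinj : Set.InjOn (window (r + 2) f) (Finset.range N) := by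
    intro s hs t ht hst
    have := hpos _ (by omega) _ _ hst
    rw [Finset.coe_range] at hs ht
    exact this.eq_of_lt_of_lt hs ht
  have hHcard : H.card = N := by
    rw [Finset.card_image_of_injOn hinj, Finset.card_range]
  have hsrc : ∀ e ∈ (H : Set (Fin (r + 2) → Ω)), ∀ e' ∈ (H : Set (Fin (r + 2) → Ω)),
      Fin.init e = Fin.init e' → e = e' := by
    intro e he e' he' h
    obtain ⟨s, rfl⟩ := hH' e he
    obtain ⟨t, rfl⟩ := hH' e' he'
    exact hf.window_congr (hpos _ hnr s t h) _
  have htgt : ∀ e ∈ (H : Set (Fin (r + 2) → Ω)), ∀ e' ∈ (H : Set (Fin (r + 2) → Ω)),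
      Fin.tail e = Fin.tail e' → e = e' := by
    intro e he e' he' h
    obtain ⟨s, rfl⟩ := hH' e he
    obtain ⟨t, rfl⟩ := hH' e' he'
    rw [tail_window, tail_window] at h
    exact hf.window_congr (Nat.ModEq.add_right_cancel' 1 (hpos _ hnr _ _ h)) _
  have hmid : 3 ≤ Fintype.card Ω ∨ ∀ e ∈ (H : Set (Fin (r + 2) → Ω)),
      ∀ e' ∈ (H : Set (Fin (r + 2) → Ω)),
      Fin.init (Fin.tail e) = Fin.init (Fin.tail e') → e = e' := by
    refine hbig.imp_right fun hr e he e' he' h => ?_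
    obtain ⟨s, rfl⟩ := hH' e he
    obtain ⟨t, rfl⟩ := hH' e' he'
    rw [tail_window, tail_window, init_window, init_window] at h
    exact hf.window_congr (Nat.ModEq.add_right_cancel' 1 (hpos _ hr _ _ h)) _
  -- The rotation of words shows that the whole graph is balanced; the deleted cycle is balanced.
  have hbalE : ∀ u : Fin (r + 1) → Ω,
      (Finset.univ.filter fun e : Fin (r + 2) → Ω => Fin.tail e = u).card =
        (Finset.univ.filter fun e : Fin (r + 2) → Ω => Fin.init e = u).card := by
    intro u
    refine Finset.card_bij' (fun e _ => Fin.snoc (α := fun _ => Ω) (Fin.tail e) (e 0))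
      (fun e _ => Fin.cons (α := fun _ => Ω) (e (Fin.last _)) (Fin.init e)) ?_ ?_ ?_ ?_
    · intro e he; simpa using he
    · intro e he; simpa using he
    · intro e he; simp
    · intro e he; simp
  have hbalH : ∀ u : Fin (r + 1) → Ω, (H.filter fun e => Fin.tail e = u).card =
      (H.filter fun e => Fin.init e = u).card := by
    intro u
    have h1 : ∀ (P : (Fin (r + 2) → Ω) → Prop) [DecidablePred P], (H.filter P).card =
        ((Finset.range N).filter fun s => P (window (r + 2) f s)).card := by
      intro P _
      rw [Finset.filter_image, Finset.card_image_of_injOn]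
      exact hinj.mono (Finset.coe_subset.2 (Finset.filter_subset _ _))
    rw [h1, h1]
    simp only [tail_window, init_window]
    have h2 := Nat.filter_Ico_card_eq_of_periodic 1 N (fun s => window (r + 1) f s = u)
      (fun s => by
        change (window (r + 1) f (s + N) = u) = (window (r + 1) f s = u)
        rw [hf.window_congr (s := s + N) (t := s) (by simp [N, Nat.ModEq])])
    rw [Nat.count_eq_card_filter_range] at h2
    refine Eq.trans ?_ (h2.trans (by congr))
    rw [Finset.range_eq_Ico]
    refine Finset.card_bij' (fun s _ => s + 1) (fun s _ => s - 1) ?_ ?_ ?_ ?_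
    · intro s hs; simp only [Finset.mem_filter, Finset.mem_Ico] at hs ⊢; exact ⟨by omega, hs.2⟩
    · intro s hs
      simp only [Finset.mem_filter, Finset.mem_Ico] at hs ⊢
      rw [Nat.sub_add_cancel (by omega)]; exact ⟨by omega, hs.2⟩
    · intro s _; simp
    · intro s hs; simp only [Finset.mem_filter, Finset.mem_Ico] at hs; omega
  have hbal : ∀ u : Fin (r + 1) → Ω,
      Fintype.card {e : {e // e ∉ (H : Set (Fin (r + 2) → Ω))} // Fin.tail e.1 = u} =
      Fintype.card {e : {e // e ∉ (H : Set (Fin (r + 2) → Ω))} // Fin.init e.1 = u} := by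
    intro u
    have h1 : ∀ (P : (Fin (r + 2) → Ω) → Prop) [DecidablePred P],
        Fintype.card {e : {e // e ∉ (H : Set (Fin (r + 2) → Ω))} // P e.1} + (H.filter P).card =
          (Finset.univ.filter P).card := by
      intro P _
      rw [Fintype.card_congr (Equiv.subtypeSubtypeEquivSubtypeInter
        (fun e => e ∉ (H : Set (Fin (r + 2) → Ω))) P), Fintype.card_subtype,
        ← Finset.card_union_of_disjoint]
      · congr 1
        ext e
        simp only [Finset.mem_union, Finset.mem_filter, Finset.mem_univ, true_and,
          Finset.mem_coe]
        tauto
      · rw [Finset.disjoint_left]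
        intro e he he'
        simp only [Finset.mem_filter, Finset.mem_univ, true_and, Finset.mem_coe] at he he'
        exact he.1 he'.1
    have ht : Fintype.card {e : {e // e ∉ (H : Set (Fin (r + 2) → Ω))} // Fin.tail e.1 = u} +
        (H.filter fun e => Fin.tail e = u).card =
        (Finset.univ.filter fun e : Fin (r + 2) → Ω => Fin.tail e = u).card := by
      convert h1 (fun e => Fin.tail e = u)
    have hs : Fintype.card {e : {e // e ∉ (H : Set (Fin (r + 2) → Ω))} // Fin.init e.1 = u} +
        (H.filter fun e => Fin.init e = u).card =
        (Finset.univ.filter fun e : Fin (r + 2) → Ω => Fin.init e = u).card := by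
      convert h1 (fun e => Fin.init e = u)
    have := hbalE u
    have := hbalH u
    omega
  -- Some edge out of the first vertex of the cycle is left.
  obtain ⟨e₀, he₀⟩ : ∃ e : {e // e ∉ (H : Set (Fin (r + 2) → Ω))},
      Fin.init e.1 = window (r + 1) f 0 := by
    obtain ⟨a, a', haa'⟩ := Fintype.one_lt_card_iff.1 (show 1 < Fintype.card Ω by omega)
    by_contra! hno
    have hmem : ∀ d, Fin.snoc (α := fun _ => Ω) (window (r + 1) f 0) d ∈
        (H : Set (Fin (r + 2) → Ω)) := fun d => by
      by_contra h
      exact hno ⟨_, h⟩ (Fin.init_snoc _ _)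
    have := hsrc _ (hmem a) _ (hmem a') (by rw [Fin.init_snoc, Fin.init_snoc])
    have h2 := congrFun this (Fin.last (r + 1))
    simp only [Fin.snoc_last] at h2
    exact haa' h2
  obtain ⟨c, hc0, hcN, hcs, hcall⟩ := exists_eulerian_circuit
    (fun e : {e // e ∉ (H : Set (Fin (r + 2) → Ω))} => Fin.init e.1) (fun e => Fin.tail e.1)
    e₀ hbal (fun C hC h1 h2 h3 => residual_connected hb _ hsrc htgt hmid C hC h1 h2 h3)
  set M := Fintype.card {e // e ∉ (H : Set (Fin (r + 2) → Ω))} with hM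
  have hMpos : 0 < M := Fintype.card_pos_iff.2 ⟨e₀⟩
  have hNM : N + M = Fintype.card Ω ^ (r + 2) := by
    have h1 : Fintype.card (Fin (r + 2) → Ω) = Fintype.card Ω ^ (r + 2) := by simp
    rw [← h1, ← hHcard, hM, Fintype.card_subtype_compl]
    have h2 : Fintype.card {e // e ∈ (H : Set (Fin (r + 2) → Ω))} = H.card := by
      rw [Fintype.card_subtype]; congr 1; ext; simp
    rw [h2]
    have := Finset.card_le_univ H
    omega
  -- The two closed walks one after the other, both starting at the same vertex.
  let E : ℕ → Fin (r + 2) → Ω := fun t => if t < N then window (r + 2) f t else (c (t - N)).1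
  have hE1 : ∀ t, t + 1 < N + M → Fin.init (E (t + 1)) = Fin.tail (E t) := by
    intro t ht
    by_cases h1 : t + 1 < N
    · simp only [E, h1, show t < N by omega, if_true, tail_window, init_window]
    by_cases h2 : t < N
    · have h3 : t + 1 = N := by omega
      have h4 : E (t + 1) = e₀.1 := by
        simp only [E, h1, if_false]
        rw [h3, Nat.sub_self, hc0]
      rw [h4, he₀]
      simp only [E, h2, if_true, tail_window, h3]
      exact hf.window_congr (by simp [Nat.ModEq, N]) _
    · simp only [E, h1, h2, if_false, show t + 1 - N = (t - N) + 1 by omega]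
      exact hcs _
  have hE2 : Fin.init (E 0) = Fin.tail (E (N + M - 1)) := by
    have h1 : ¬ N + M - 1 < N := by omega
    simp only [E, hNpos, h1, if_true, if_false, init_window]
    rw [← he₀, ← hcs, show N + M - 1 - N + 1 = M by omega, hcN]
  have hE3 : ∀ t, Fin.init (E ((t + 1) % (N + M))) = Fin.tail (E (t % (N + M))) := by
    intro t
    have hlt := Nat.mod_lt t (show 0 < N + M by omega)
    by_cases h : t % (N + M) + 1 < N + M
    · rw [← hE1 _ h, Nat.add_mod, Nat.mod_eq_of_lt (show 1 < N + M by omega), Nat.mod_eq_of_lt h]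
    · have h4 : t % (N + M) = N + M - 1 := by omega
      have h5 : (t + 1) % (N + M) = 0 := by
        rw [Nat.add_mod, h4, Nat.mod_eq_of_lt (show 1 < N + M by omega),
          Nat.sub_add_cancel (by omega), Nat.mod_self]
      rw [h5, h4, hE2]
  let f' : ℕ → Ω := fun t => E (t % (N + M)) 0
  have hwin : ∀ i (hi : i < r + 2) t, f' (t + i) = E (t % (N + M)) ⟨i, hi⟩ := by
    intro i
    induction i with
    | zero => intro _ _; rfl
    | succ i ih =>
      intro hi t
      rw [show t + (i + 1) = (t + 1) + i by omega, ih (by omega)]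
      have := congrFun (hE3 t) ⟨i, by omega⟩
      exact this
  have hwin' : ∀ t < N + M, window (r + 2) f' t = E t := by
    intro t ht
    funext i
    rw [window, hwin _ i.isLt, Nat.mod_eq_of_lt ht]
  have hsurj : ∀ e, ∃ t ∈ Finset.range (N + M), window (r + 2) f' t = e := by
    intro e
    by_cases he : e ∈ H
    · obtain ⟨s, hs, rfl⟩ := Finset.mem_image.1 he
      rw [Finset.mem_range] at hs
      refine ⟨s, Finset.mem_range.2 (by omega), ?_⟩
      rw [hwin' _ (by omega)]
      simp only [E, hs, if_true]
    · obtain ⟨t, ht, hte⟩ := hcall ⟨e, he⟩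
      refine ⟨N + t, Finset.mem_range.2 (by omega), ?_⟩
      rw [hwin' _ (by omega)]
      simp only [E, show ¬ N + t < N by omega, if_false, Nat.add_sub_cancel_left, hte]
  refine ⟨f', ⟨fun t => ?_, ?_⟩, fun s hs => ?_⟩
  · simp only [f', ← hNM, Nat.add_mod_right]
  · rw [← hNM]
    have himg : (Finset.range (N + M)).image (window (r + 2) f') = Finset.univ := by
      ext e
      simpa using hsurj e
    have hI : Set.InjOn (window (r + 2) f') (Finset.range (N + M)) := by
      rw [← Finset.card_image_iff, himg, Finset.card_range, hNM]
      simp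
    intro s hs t ht hst
    exact hI (by simpa using hs) (by simpa using ht) hst
  · simp only [f', Nat.mod_eq_of_lt (show s < N + M by omega), E, hs, if_true]
    rfl

/-! ### Existence of infinite de Bruijn sequences -/

theorem factor_length {Ω : Type*} (x : ℕ → Ω) (s n : ℕ) : (factor x s n).length = n := by
  simp [factor]

theorem initSeg_length {Ω : Type*} (x : ℕ → Ω) (n : ℕ) : (initSeg x n).length = n :=
  factor_length x 0 n

theorem factor_getElem {Ω : Type*} (x : ℕ → Ω) (s n i : ℕ) (h : i < (factor x s n).length) :
    (factor x s n)[i] = x (s + i) := by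
  simp [factor]

theorem initSeg_getElem {Ω : Type*} (x : ℕ → Ω) (n i : ℕ) (h : i < (initSeg x n).length) :
    (initSeg x n)[i] = x i := by
  simp [initSeg, factor]

theorem IsPeriodicDeBruijn.isCyclicDeBruijn {Ω : Type*} [Fintype Ω] {n : ℕ} {f A : ℕ → Ω}
    (hb : 2 ≤ Fintype.card Ω) (hf : IsPeriodicDeBruijn n f)
    (hA : ∀ s < Fintype.card Ω ^ n, A s = f s) :
    IsCyclicDeBruijn n (initSeg A (Fintype.card Ω ^ n)) := by
  classical
  set N := Fintype.card Ω ^ n with hN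
  have hnN : n < N := Nat.lt_pow_self hb
  have key : ∀ s, ((initSeg A N).rotate s).take n = List.ofFn (window n f s) := by
    intro s
    apply List.ext_getElem
    · simp [initSeg_length, hnN.le]
    · intro i h1 h2
      simp only [List.getElem_take, List.getElem_rotate, initSeg_getElem, initSeg_length,
        List.getElem_ofFn, window]
      rw [hA _ (Nat.mod_lt _ (by omega)), hf.periodic.map_mod_nat, add_comm]
  refine ⟨initSeg_length _ _, fun u hu => ?_⟩
  simp only [key, initSeg_length]
  have hinj : Set.InjOn (window n f) (Finset.range N) := fun s hs t ht h =>
    hf.inj s (by simpa using hs) t (by simpa using ht) h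
  have himg : (Finset.range N).image (window n f) = Finset.univ := by
    rw [← Finset.card_eq_iff_eq_univ, Finset.card_image_of_injOn hinj]
    simp [hN]
  obtain ⟨s, hs, hsu⟩ : ∃ s ∈ Finset.range N, window n f s = fun i : Fin n => u[i] := by
    rw [← Finset.mem_image, himg]; exact Finset.mem_univ _
  have hu' : List.ofFn (fun i : Fin n => u[i]) = u := by
    subst hu; exact List.ofFn_getElem
  refine ⟨s, ⟨Finset.mem_range.1 hs, by rw [hsu, hu']⟩, fun t ht => ?_⟩
  refine hf.inj t ht.1 s (Finset.mem_range.1 hs) ?_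
  rw [hsu]
  exact List.ofFn_injective (ht.2.trans hu'.symm)

theorem exists_isPeriodicDeBruijn_one (Ω : Type*) [Fintype Ω] [Nonempty Ω] :
    ∃ f : ℕ → Ω, IsPeriodicDeBruijn 1 f := by
  have hpos : 0 < Fintype.card Ω := Fintype.card_pos
  let φ := (Fintype.equivFin Ω).symm
  refine ⟨fun t => φ ⟨t % Fintype.card Ω, Nat.mod_lt _ hpos⟩, fun t => by simp, ?_⟩
  intro s hs t ht h
  rw [pow_one] at hs ht
  have h0 := φ.injective (congrFun h 0)
  simpa [Nat.mod_eq_of_lt hs, Nat.mod_eq_of_lt ht] using h0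

/-- Extending again and again, by `d` orders at a time, gives an infinite sequence. -/
theorem exists_sequence_of_extensions {Ω : Type*} [Fintype Ω] (hb : 2 ≤ Fintype.card Ω)
    (d : ℕ) (hd : 1 ≤ d) (hbig : 3 ≤ Fintype.card Ω ∨ 2 ≤ d) :
    ∃ A : ℕ → Ω, ∀ j, IsCyclicDeBruijn (d * j + 1) (initSeg A (Fintype.card Ω ^ (d * j + 1))) := by
  have : Nonempty Ω := Fintype.card_pos_iff.1 (by omega)
  obtain ⟨f₀, hf₀⟩ := exists_isPeriodicDeBruijn_one Ω
  have hext : ∀ (j : ℕ) (f : ℕ → Ω), ∃ f' : ℕ → Ω, IsPeriodicDeBruijn (d * j + 1) f →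
      IsPeriodicDeBruijn (d * (j + 1) + 1) f' ∧
        ∀ s < Fintype.card Ω ^ (d * j + 1), f' s = f s := by
    intro j f
    by_cases hf : IsPeriodicDeBruijn (d * j + 1) f
    · obtain ⟨f', h1, h2⟩ := hf.exists_extension (r := d * (j + 1) - 1) hb
        (by rw [mul_add]; omega) (hbig.imp_right fun h => by rw [mul_add]; omega)
      refine ⟨f', fun _ => ⟨?_, h2⟩⟩
      convert h1 using 1
      rw [mul_add]; omega
    · exact ⟨f, fun h => absurd h hf⟩
  choose ext hext using hext
  let F : ℕ → ℕ → Ω := fun j => Nat.rec f₀ (fun j f => ext j f) j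
  have hF : ∀ j, IsPeriodicDeBruijn (d * j + 1) (F j) := by
    intro j
    induction j with
    | zero => exact hf₀
    | succ j ih => exact (hext j _ ih).1
  have hmono : ∀ j i, ∀ s < Fintype.card Ω ^ (d * j + 1), F (j + i) s = F j s := by
    intro j i
    induction i with
    | zero => intro s _; rfl
    | succ i ih =>
      intro s hs
      rw [← ih s hs]
      refine (hext (j + i) _ (hF _)).2 s (hs.trans_le ?_)
      exact Nat.pow_le_pow_right (by omega) (by rw [mul_add]; omega)
  refine ⟨fun t => F t t, fun j => (hF j).isCyclicDeBruijn hb fun s hs => ?_⟩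
  rcases le_total j s with h | h
  · obtain ⟨i, rfl⟩ := Nat.exists_eq_add_of_le h
    exact hmono j i _ hs
  · obtain ⟨i, rfl⟩ := Nat.exists_eq_add_of_le h
    refine (hmono s i s ?_).symm
    refine (Nat.lt_pow_self hb).trans_le (Nat.pow_le_pow_right (by omega) ?_)
    nlinarith

theorem exists_isInfiniteDeBruijn {Ω : Type*} [Fintype Ω] (hb : 2 ≤ Fintype.card Ω) :
    ∃ A : ℕ → Ω, IsInfiniteDeBruijn A := by
  by_cases h3 : 3 ≤ Fintype.card Ω
  · obtain ⟨A, hA⟩ := exists_sequence_of_extensions (Ω := Ω) hb 1 le_rfl (Or.inl h3)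
    refine ⟨A, fun _ k hk => ?_, fun h => by omega⟩
    have := hA (k - 1)
    rwa [one_mul, Nat.sub_add_cancel hk] at this
  · have h2 : Fintype.card Ω = 2 := by omega
    obtain ⟨A, hA⟩ := exists_sequence_of_extensions (Ω := Ω) hb 2 (by omega) (Or.inr le_rfl)
    refine ⟨A, fun h => absurd h h3, fun _ k hk => ?_⟩
    have := hA (k - 1)
    rwa [show 2 * (k - 1) + 1 = 2 * k - 1 by omega, h2] at this

/-! ### Digits and the lengths of the selected blocks -/

theorem sum_digit_div_eq_floor {b : ℕ} (hb : 2 ≤ b) {y : ℝ} (hy1 : y < 1) (n : ℕ) :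
    ∑ j ∈ Finset.Icc 1 n, (digit b y j : ℝ) / (b : ℝ) ^ j =
      (⌊y * (b : ℝ) ^ n⌋₊ : ℝ) / (b : ℝ) ^ n := by
  have hb0 : (b : ℝ) ≠ 0 := by positivity
  induction n with
  | zero => simp [Nat.floor_eq_zero.2 hy1]
  | succ n ih =>
    rw [Finset.sum_Icc_succ_top (by omega), ih]
    have h1 : ⌊y * (b : ℝ) ^ n⌋₊ = ⌊y * (b : ℝ) ^ (n + 1)⌋₊ / b := by
      rw [← Nat.floor_div_natCast]
      congr 1
      field_simp
      ring
    have h2 := Nat.div_add_mod ⌊y * (b : ℝ) ^ (n + 1)⌋₊ b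
    rw [← h1] at h2
    have h3 : (b : ℝ) * (⌊y * (b : ℝ) ^ n⌋₊ : ℝ) + (⌊y * (b : ℝ) ^ (n + 1)⌋₊ % b : ℕ) =
        (⌊y * (b : ℝ) ^ (n + 1)⌋₊ : ℝ) := by exact_mod_cast h2
    rw [digit, if_neg hy1.ne, ← h3]
    field_simp
    ring

theorem sum_digit_one {b : ℕ} (hb : 2 ≤ b) (n : ℕ) :
    ∑ j ∈ Finset.Icc 1 n, (digit b 1 j : ℝ) / (b : ℝ) ^ j = 1 - 1 / (b : ℝ) ^ n := by
  have hb0 : (b : ℝ) ≠ 0 := by positivity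
  induction n with
  | zero => simp
  | succ n ih =>
    rw [Finset.sum_Icc_succ_top (by omega), ih, digit, if_pos rfl, Nat.cast_sub (by omega)]
    field_simp
    push_cast
    ring

theorem sum_digit_le {b : ℕ} (hb : 2 ≤ b) {y : ℝ} (hy0 : 0 ≤ y) (hy1 : y ≤ 1) (n : ℕ) :
    ∑ j ∈ Finset.Icc 1 n, (digit b y j : ℝ) / (b : ℝ) ^ j ≤ y := by
  have hb0 : (0 : ℝ) < (b : ℝ) ^ n := by positivity
  rcases hy1.lt_or_eq with h | rfl
  · rw [sum_digit_div_eq_floor hb h, div_le_iff₀ hb0]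
    exact Nat.floor_le (by positivity)
  · rw [sum_digit_one hb]
    linarith [show 0 ≤ 1 / (b : ℝ) ^ n by positivity]

theorem le_sum_digit {b : ℕ} (hb : 2 ≤ b) {y : ℝ} (hy0 : 0 ≤ y) (hy1 : y ≤ 1) (n : ℕ) :
    y - 1 / (b : ℝ) ^ n ≤ ∑ j ∈ Finset.Icc 1 n, (digit b y j : ℝ) / (b : ℝ) ^ j := by
  have hb0 : (0 : ℝ) < (b : ℝ) ^ n := by positivity
  rcases hy1.lt_or_eq with h | rfl
  · rw [sum_digit_div_eq_floor hb h, le_div_iff₀ hb0, sub_mul, one_div_mul_cancel hb0.ne']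
    linarith [Nat.lt_floor_add_one (y * (b : ℝ) ^ n)]
  · rw [sum_digit_one hb]

theorem digit_le {b : ℕ} (hb : 2 ≤ b) (y : ℝ) (j : ℕ) : digit b y j ≤ b := by
  unfold digit
  split_ifs
  · omega
  · exact (Nat.mod_lt _ (by omega)).le

theorem digit_eq_zero {b : ℕ} (hb : 2 ≤ b) {y : ℝ} {j n : ℕ} (hy : y < 1 / (b : ℝ) ^ n)
    (hj : j ≤ n) : digit b y j = 0 := by
  have hb1 : (1 : ℝ) ≤ b := by exact_mod_cast (by omega : 1 ≤ b)
  have hbn : (0 : ℝ) < (b : ℝ) ^ n := by positivity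
  have hbj : (0 : ℝ) < (b : ℝ) ^ j := by positivity
  have hy1 : y < 1 / (b : ℝ) ^ j :=
    hy.trans_le (one_div_le_one_div_of_le hbj (pow_le_pow_right₀ hb1 hj))
  have hy2 : y * (b : ℝ) ^ j < 1 := (lt_div_iff₀ hbj).1 hy1
  have hy3 : y ≠ 1 := by
    rintro rfl
    exact absurd (one_le_pow₀ hb1 : (1 : ℝ) ≤ (b : ℝ) ^ j) (by linarith)
  rw [digit, if_neg hy3, Nat.floor_eq_zero.2 hy2, Nat.zero_mod]

theorem stepNumber_nonneg {b : ℕ} (hb : 2 ≤ b) {p : ℕ → ℝ} (hp : ∀ i, 0 ≤ p i) (k i : ℕ) :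
    0 ≤ stepNumber b p k i := by
  have hb1 : (2 : ℝ) ≤ b := by exact_mod_cast hb
  unfold stepNumber
  split_ifs
  · exact hp i
  · exact mul_nonneg (div_nonneg (by linarith) (by linarith)) (hp i)

theorem stepNumber_le {b : ℕ} (hb : 2 ≤ b) {p : ℕ → ℝ} (hp : ∀ i, 0 ≤ p i) (k i : ℕ) :
    stepNumber b p k i ≤ p i := by
  have hb1 : (2 : ℝ) ≤ b := by exact_mod_cast hb
  unfold stepNumber
  split_ifs
  · exact le_rfl
  · refine mul_le_of_le_one_left (hp i) ?_
    rw [div_le_one (by linarith)]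
    linarith

/-- The numbers of the steps up to `k`, weighted with the lengths of the initial segments of `A`
from which the blocks are taken, add up to the fraction `p i` of the last of these lengths. -/
theorem sum_stepNumber {b : ℕ} (hb : 2 ≤ b) (p : ℕ → ℝ) (k i : ℕ) (hk : 1 ≤ k) :
    ∑ l ∈ Finset.Icc 1 k, stepNumber b p l i * (b : ℝ) ^ l = p i * (b : ℝ) ^ k := by
  have hb0 : (b : ℝ) ≠ 0 := by positivity
  induction k, hk using Nat.le_induction with
  | base => simp [stepNumber]
  | succ k hk ih =>
    rw [Finset.sum_Icc_succ_top (by omega), ih, stepNumber, if_neg (by omega)]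
    field_simp
    ring

/-- The total length of the blocks selected in step `k` for the multiplicity `i`. -/
noncomputable def stepLength (b : ℕ) (p : ℕ → ℝ) (k i : ℕ) : ℕ :=
  ∑ j ∈ Finset.Icc 1 (g k), digit b (stepNumber b p k i) j * b ^ (k - j)

theorem stepLength_eq {b : ℕ} (hb : 2 ≤ b) (p : ℕ → ℝ) (k i : ℕ) :
    (stepLength b p k i : ℝ) =
      (∑ j ∈ Finset.Icc 1 (g k), (digit b (stepNumber b p k i) j : ℝ) / (b : ℝ) ^ j) * b ^ k := by
  have hb0 : (b : ℝ) ≠ 0 := by positivity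
  unfold stepLength
  rw [Nat.cast_sum, Finset.sum_mul]
  refine Finset.sum_congr rfl fun j hj => ?_
  rw [Finset.mem_Icc, g] at hj
  rw [Nat.cast_mul, Nat.cast_pow, pow_sub₀ _ hb0 (by omega)]
  field_simp

/-- The total length of the blocks selected up to step `k` for the multiplicity `i`. -/
noncomputable def selectedLength (b : ℕ) (p : ℕ → ℝ) (k i : ℕ) : ℕ :=
  ∑ l ∈ Finset.Icc 1 k, stepLength b p l i

section bounds

variable {b : ℕ} {p : ℕ → ℝ}

theorem selectedLength_le (hb : 2 ≤ b) (hp : ∀ i, 0 ≤ p i) (hp1 : ∀ i, p i ≤ 1) (k i : ℕ) :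
    (selectedLength b p k i : ℝ) ≤ p i * (b : ℝ) ^ k := by
  rcases Nat.eq_zero_or_pos k with rfl | hk
  · simpa [selectedLength] using hp i
  rw [← sum_stepNumber hb p k i hk, selectedLength, Nat.cast_sum]
  refine Finset.sum_le_sum fun l _ => ?_
  rw [stepLength_eq hb]
  gcongr
  exact sum_digit_le hb (stepNumber_nonneg hb hp l i) ((stepNumber_le hb hp l i).trans (hp1 i)) _

theorem le_selectedLength (hb : 2 ≤ b) (hp : ∀ i, 0 ≤ p i) (hp1 : ∀ i, p i ≤ 1) {k : ℕ}
    (hk : 1 ≤ k) (i : ℕ) :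
    p i * (b : ℝ) ^ k - k * (b : ℝ) ^ (k / 2) ≤ selectedLength b p k i := by
  have hb0 : (b : ℝ) ≠ 0 := by positivity
  have hb1 : (1 : ℝ) ≤ b := by exact_mod_cast (by omega : 1 ≤ b)
  have h1 : ∑ l ∈ Finset.Icc 1 k, (b : ℝ) ^ (l / 2) ≤ k * (b : ℝ) ^ (k / 2) := by
    have := Finset.sum_le_card_nsmul (Finset.Icc 1 k) (fun l => (b : ℝ) ^ (l / 2))
      ((b : ℝ) ^ (k / 2)) fun l hl => by
        rw [Finset.mem_Icc] at hl
        exact pow_le_pow_right₀ hb1 (by omega)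
    simpa using this
  refine (sub_le_sub_left h1 _).trans ?_
  rw [← sum_stepNumber hb p k i hk, selectedLength, Nat.cast_sum, ← Finset.sum_sub_distrib]
  refine Finset.sum_le_sum fun l hl => ?_
  rw [stepLength_eq hb]
  have h2 := le_sum_digit hb (stepNumber_nonneg hb hp l i)
    ((stepNumber_le hb hp l i).trans (hp1 i)) (g l)
  have h3 : (b : ℝ) ^ (l / 2) = 1 / (b : ℝ) ^ (g l) * (b : ℝ) ^ l := by
    have : l = l / 2 + g l := by unfold g; omega
    conv_rhs => rw [this, pow_add]
    rw [← this]
    field_simp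
  rw [h3, ← sub_mul]
  gcongr

/-- The number of blocks selected up to step `k` for a fixed multiplicity is polynomial in `k`. -/
theorem sum_sum_digit_le (hb : 2 ≤ b) (p : ℕ → ℝ) (k i : ℕ) :
    ∑ l ∈ Finset.Icc 1 k, ∑ j ∈ Finset.Icc 1 (g l), digit b (stepNumber b p l i) j
      ≤ k * k * b := by
  have h1 : ∀ l ∈ Finset.Icc 1 k,
      ∑ j ∈ Finset.Icc 1 (g l), digit b (stepNumber b p l i) j ≤ k * b := by
    intro l hl
    have := Finset.sum_le_card_nsmul (Finset.Icc 1 (g l))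
      (fun j => digit b (stepNumber b p l i) j) b fun j _ => digit_le hb _ _
    rw [Nat.card_Icc, smul_eq_mul] at this
    refine this.trans (Nat.mul_le_mul_right b ?_)
    rw [Finset.mem_Icc] at hl
    unfold g; omega
  have := Finset.sum_le_card_nsmul _ _ _ h1
  rw [Nat.card_Icc, smul_eq_mul, Nat.add_sub_cancel] at this
  rwa [mul_assoc]

/-- The list `P` contains every pair (multiplicity, level) as often as the digits belonging to step
`k` prescribe. -/
def HasDigitCounts (b : ℕ) (p : ℕ → ℝ) (k : ℕ) (P : List (ℕ × ℕ)) : Prop :=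
  ∀ i j, (P : Multiset (ℕ × ℕ)).count (i, j) =
    if 1 ≤ i ∧ 1 ≤ j ∧ j ≤ g k then digit b (stepNumber b p k i) j else 0

theorem HasDigitCounts.bounds_of_mem {k : ℕ} {P : List (ℕ × ℕ)} (h : HasDigitCounts b p k P)
    {q : ℕ × ℕ} (hq : q ∈ P) : 1 ≤ q.1 ∧ 1 ≤ q.2 ∧ q.2 ≤ g k := by
  by_contra hno
  have h1 := h q.1 q.2
  rw [if_neg hno] at h1
  exact (Multiset.count_pos.2 (Multiset.mem_coe.2 hq)).ne' h1

theorem HasDigitCounts.sum_map {k : ℕ} {P : List (ℕ × ℕ)} (h : HasDigitCounts b p k P)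
    (F : Finset ℕ) (hF : ∀ q ∈ P, q.1 ∈ F) (φ : ℕ → ℕ → ℝ) (hφ : ∀ j, φ 0 j = 0) :
    (P.map fun q => φ q.1 q.2).sum =
      ∑ i ∈ F, ∑ j ∈ Finset.Icc 1 (g k), digit b (stepNumber b p k i) j * φ i j := by
  rw [Finset.sum_list_map_count, ← Finset.sum_product', Finset.sum_subset
    (s₂ := F ×ˢ Finset.Icc 1 (g k))]
  · refine Finset.sum_congr rfl fun q hq => ?_
    rw [Finset.mem_product, Finset.mem_Icc] at hq
    rcases Nat.eq_zero_or_pos q.1 with h0 | h0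
    · simp [h0, hφ]
    · rw [← Multiset.coe_count, show q = (q.1, q.2) from rfl, h q.1 q.2, if_pos ⟨h0, hq.2⟩,
        nsmul_eq_mul]
  · intro q hq
    rw [List.mem_toFinset] at hq
    rw [Finset.mem_product, Finset.mem_Icc]
    exact ⟨hF q hq, (h.bounds_of_mem hq).2⟩
  · intro q _ hq
    rw [List.mem_toFinset] at hq
    rw [← Multiset.coe_count, Multiset.count_eq_zero_of_notMem (by simpa using hq), zero_smul]

theorem HasDigitCounts.sum_length {k : ℕ} {P : List (ℕ × ℕ)} (h : HasDigitCounts b p k P)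
    (F : Finset ℕ) (hF : ∀ q ∈ P, q.1 ∈ F) (φ : ℕ → ℝ) (hφ : φ 0 = 0) :
    (P.map fun q => φ q.1 * (b : ℝ) ^ (k - q.2)).sum = ∑ i ∈ F, φ i * stepLength b p k i := by
  rw [h.sum_map F hF (fun i j => φ i * (b : ℝ) ^ (k - j)) (by simp [hφ])]
  refine Finset.sum_congr rfl fun i _ => ?_
  rw [stepLength, Nat.cast_sum, Finset.mul_sum]
  refine Finset.sum_congr rfl fun j _ => ?_
  push_cast; ring

/-- Summing over all steps up to `k`, with weights `φ` that depend on the multiplicity. -/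
theorem sum_length_eq {P : ℕ → List (ℕ × ℕ)} {k : ℕ}
    (h : ∀ l, 1 ≤ l → HasDigitCounts b p l (P l)) (F : Finset ℕ)
    (hF : ∀ l ∈ Finset.Icc 1 k, ∀ q ∈ P l, q.1 ∈ F) (φ : ℕ → ℝ) (hφ : φ 0 = 0) :
    ∑ l ∈ Finset.Icc 1 k, ((P l).map fun q => φ q.1 * (b : ℝ) ^ (l - q.2)).sum =
      ∑ i ∈ F, φ i * selectedLength b p k i := by
  rw [Finset.sum_congr rfl fun l hl =>
    (h l (Finset.mem_Icc.1 hl).1).sum_length F (hF l hl) φ hφ, Finset.sum_comm]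
  refine Finset.sum_congr rfl fun i _ => ?_
  rw [← Finset.mul_sum, selectedLength, Nat.cast_sum]

theorem exists_finset_fst (P : ℕ → List (ℕ × ℕ)) (k i : ℕ) :
    ∃ F : Finset ℕ, i ∈ F ∧ ∀ l ∈ Finset.Icc 1 k, ∀ q ∈ P l, q.1 ∈ F := by
  refine ⟨insert i ((Finset.Icc 1 k).biUnion fun l => ((P l).map Prod.fst).toFinset),
    Finset.mem_insert_self _ _, fun l hl q hq => Finset.mem_insert_of_mem ?_⟩
  exact Finset.mem_biUnion.2 ⟨l, hl, List.mem_toFinset.2 (List.mem_map_of_mem hq)⟩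

theorem sum_length_le (hb : 2 ≤ b) (hp : ∀ i, 0 ≤ p i) (hp1 : ∀ i, p i ≤ 1)
    {P : ℕ → List (ℕ × ℕ)} (h : ∀ l, 1 ≤ l → HasDigitCounts b p l (P l)) (k : ℕ) (φ : ℕ → ℝ)
    (hφ : φ 0 = 0) (hφ0 : ∀ i, 0 ≤ φ i) {M : ℝ} (hM : HasSum (fun i => φ i * p i) M) :
    ∑ l ∈ Finset.Icc 1 k, ((P l).map fun q => φ q.1 * (b : ℝ) ^ (l - q.2)).sum
      ≤ M * (b : ℝ) ^ k := by
  obtain ⟨F, -, hF⟩ := exists_finset_fst P k 0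
  rw [sum_length_eq h F hF φ hφ]
  calc ∑ i ∈ F, φ i * (selectedLength b p k i : ℝ)
      ≤ ∑ i ∈ F, φ i * (p i * (b : ℝ) ^ k) := by
        gcongr with i _
        · exact hφ0 i
        · exact selectedLength_le hb hp hp1 k i
    _ = (∑ i ∈ F, φ i * p i) * (b : ℝ) ^ k := by
        rw [Finset.sum_mul]; simp only [mul_assoc]
    _ ≤ M * (b : ℝ) ^ k := by
        gcongr
        exact sum_le_hasSum F (fun i _ => mul_nonneg (hφ0 i) (hp i)) hM

theorem le_sum_length {P : ℕ → List (ℕ × ℕ)}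
    (h : ∀ l, 1 ≤ l → HasDigitCounts b p l (P l)) (k : ℕ) (φ : ℕ → ℝ) (hφ : φ 0 = 0)
    (hφ0 : ∀ i, 0 ≤ φ i) (i : ℕ) :
    φ i * selectedLength b p k i ≤
      ∑ l ∈ Finset.Icc 1 k, ((P l).map fun q => φ q.1 * (b : ℝ) ^ (l - q.2)).sum := by
  obtain ⟨F, hi, hF⟩ := exists_finset_fst P k i
  rw [sum_length_eq h F hF φ hφ]
  exact Finset.single_le_sum
    (fun i _ => mul_nonneg (hφ0 i) (Nat.cast_nonneg (selectedLength b p k i))) hi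

/-- All but finitely many of the prescribed digits of a step are zero. -/
theorem exists_hasDigitCounts (hb : 2 ≤ b) (hp : ∀ i, 0 ≤ p i) (hsum : Summable p) (k : ℕ) :
    ∃ P : List (ℕ × ℕ), HasDigitCounts b p k P := by
  classical
  let m : ℕ × ℕ → ℕ := fun q => if 1 ≤ q.1 ∧ 1 ≤ q.2 ∧ q.2 ≤ g k then
    digit b (stepNumber b p k q.1) q.2 else 0
  have hfin : {i | ¬ p i < 1 / (b : ℝ) ^ g k}.Finite :=
    (hsum.tendsto_cofinite_zero.eventually_lt_const (by positivity))
  have hm : m.support.Finite := by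
    refine (hfin.prod (Set.finite_Icc 1 (g k))).subset fun q hq => ?_
    have hq' : m q ≠ 0 := hq
    by_cases hc : 1 ≤ q.1 ∧ 1 ≤ q.2 ∧ q.2 ≤ g k
    · refine ⟨fun hlt => hq' ?_, hc.2⟩
      simp only [m, hc, and_self, if_true]
      exact digit_eq_zero hb ((stepNumber_le hb hp k q.1).trans_lt hlt) hc.2.2
    · simp only [m, hc, if_false, ne_eq, not_true_eq_false] at hq'
  refine ⟨(Finsupp.toMultiset (Finsupp.ofSupportFinite m hm)).toList, fun i j => ?_⟩
  rw [Multiset.coe_toList, Finsupp.count_toMultiset]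
  rfl

end bounds

theorem tendsto_nat_pow_mul_pow_div {b : ℕ} (hb : 2 ≤ b) :
    Tendsto (fun k : ℕ => ((k : ℝ) * (b : ℝ) ^ (k / 2)) / (b : ℝ) ^ k) atTop (𝓝 0) := by
  have hb0 : (0 : ℝ) < b := by positivity
  have hb1 : (1 : ℝ) < b := by exact_mod_cast (by omega : 1 < b)
  have h1 := tendsto_pow_const_div_const_pow_of_one_lt 1 hb1
  have h2 : Tendsto (fun k : ℕ => 2 * (((k / 2 + 1 : ℕ) : ℝ) ^ 1 / (b : ℝ) ^ (k / 2 + 1)) * b)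
      atTop (𝓝 0) := by
    have h3 : Tendsto (fun k : ℕ => k / 2 + 1) atTop atTop :=
      tendsto_add_atTop_nat 1 |>.comp (Nat.tendsto_div_const_atTop (by norm_num))
    simpa using ((h1.comp h3).const_mul 2).mul_const (b : ℝ)
  refine squeeze_zero (fun k => by positivity) (fun k => ?_) h2
  have h4 : (b : ℝ) ^ (k / 2) * (b : ℝ) ^ (k / 2) ≤ (b : ℝ) ^ k := by
    rw [← pow_add]
    exact pow_le_pow_right₀ hb1.le (by omega)
  have h5 : (k : ℝ) ≤ 2 * ((k / 2 + 1 : ℕ) : ℝ) := by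
    have : k ≤ 2 * (k / 2 + 1) := by omega
    exact_mod_cast this
  have h6 : (0 : ℝ) < (b : ℝ) ^ (k / 2) := by positivity
  rw [div_le_iff₀ (by positivity), pow_one, pow_succ]
  calc (k : ℝ) * (b : ℝ) ^ (k / 2) ≤ 2 * ((k / 2 + 1 : ℕ) : ℝ) * (b : ℝ) ^ (k / 2) := by gcongr
    _ = 2 * (((k / 2 + 1 : ℕ) : ℝ) / ((b : ℝ) ^ (k / 2) * b)) * b *
        ((b : ℝ) ^ (k / 2) * (b : ℝ) ^ (k / 2)) := by field_simp
    _ ≤ _ := by gcongr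

theorem tendsto_selectedLength_div {b : ℕ} (hb : 2 ≤ b) {p : ℕ → ℝ} (hp : ∀ i, 0 ≤ p i)
    (hp1 : ∀ i, p i ≤ 1) (i : ℕ) :
    Tendsto (fun k => (selectedLength b p k i : ℝ) / (b : ℝ) ^ k) atTop (𝓝 (p i)) := by
  have hb0 : (0 : ℝ) < b := by positivity
  refine tendsto_of_tendsto_of_tendsto_of_le_of_le'
    (g := fun k : ℕ => p i - ((k : ℝ) * (b : ℝ) ^ (k / 2)) / (b : ℝ) ^ k)
    (by simpa using (tendsto_nat_pow_mul_pow_div hb).const_sub (p i)) tendsto_const_nhds ?_ ?_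
  · filter_upwards [eventually_ge_atTop 1] with k hk
    rw [le_div_iff₀ (by positivity), sub_mul, div_mul_cancel₀ _ (by positivity)]
    exact le_selectedLength hb hp hp1 hk i
  · refine Eventually.of_forall fun k => ?_
    rw [div_le_iff₀ (by positivity)]
    exact selectedLength_le hb hp hp1 k i

/-! ### Carrying out the construction -/

theorem hasDigitCounts_map_iff {b : ℕ} {p : ℕ → ℝ} {k : ℕ} {L : List Block} :
    HasDigitCounts b p k (L.map fun β => (β.mult, β.level)) ↔
      ∀ i j : ℕ, L.countP (fun β => decide (β.mult = i ∧ β.level = j)) =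
        if 1 ≤ i ∧ 1 ≤ j ∧ j ≤ g k then digit b (stepNumber b p k i) j else 0 := by
  unfold HasDigitCounts
  refine forall₂_congr fun i j => ?_
  have h : ((L.map fun β => (β.mult, β.level) : List (ℕ × ℕ)) : Multiset (ℕ × ℕ)).count (i, j) =
      L.countP fun β => decide (β.mult = i ∧ β.level = j) := by
    rw [Multiset.count, Multiset.coe_countP, List.countP_map]
    refine List.countP_congr fun β _ => ?_
    simp only [Function.comp_apply, decide_eq_true_eq, Prod.mk.injEq, @eq_comm _ i, @eq_comm _ j]
  rw [h]

/-- Blocks of a step `k` with prescribed pairs (multiplicity, level), placed one after the other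
from position `s` on. -/
def placeBlocks (b k : ℕ) : ℕ → List (ℕ × ℕ) → List Block
  | _, [] => []
  | s, q :: P => ⟨s, q.2, q.1⟩ :: placeBlocks b k (s + b ^ (k - q.2)) P

/-- The total length of blocks of step `k` with the given pairs (multiplicity, level). -/
def totalLength (b k : ℕ) (P : List (ℕ × ℕ)) : ℕ :=
  (P.map fun q => b ^ (k - q.2)).sum

theorem map_placeBlocks (b k : ℕ) (P : List (ℕ × ℕ)) (s : ℕ) :
    (placeBlocks b k s P).map (fun β => (β.mult, β.level)) = P := by
  induction P generalizing s with
  | nil => rfl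
  | cons q P ih => simp [placeBlocks, ih]

theorem bounds_of_mem_placeBlocks (b k : ℕ) (P : List (ℕ × ℕ)) (s : ℕ) :
    ∀ β ∈ placeBlocks b k s P,
      s ≤ β.start ∧ β.start + β.len b k ≤ s + totalLength b k P := by
  induction P generalizing s with
  | nil => simp [placeBlocks]
  | cons q P ih =>
    intro β hβ
    rw [placeBlocks, List.mem_cons] at hβ
    simp only [totalLength, List.map_cons, List.sum_cons]
    rcases hβ with rfl | hβ
    · simp only [Block.len]; omega
    · have := ih _ β hβ
      rw [totalLength] at this
      omega

theorem pairwise_placeBlocks (b k : ℕ) (P : List (ℕ × ℕ)) (s : ℕ) :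
    (placeBlocks b k s P).Pairwise
      fun β γ => Disjoint (β.positions b k) (γ.positions b k) := by
  induction P generalizing s with
  | nil => simp [placeBlocks]
  | cons q P ih =>
    rw [placeBlocks, List.pairwise_cons]
    refine ⟨fun γ hγ => ?_, ih _⟩
    have := bounds_of_mem_placeBlocks b k P _ γ hγ
    rw [Finset.disjoint_left]
    intro m hm hm'
    simp only [Block.positions, Block.len, Finset.mem_Ico] at hm hm'
    omega

theorem mem_positions_placeBlocks (b k : ℕ) (P : List (ℕ × ℕ)) (s m : ℕ) :
    (∃ β ∈ placeBlocks b k s P, m ∈ β.positions b k) ↔ s ≤ m ∧ m < s + totalLength b k P := by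
  induction P generalizing s with
  | nil => simp [placeBlocks, totalLength]
  | cons q P ih =>
    simp only [placeBlocks, List.exists_mem_cons_iff, ih]
    simp only [Block.positions, Block.len, Finset.mem_Ico, totalLength, List.map_cons,
      List.sum_cons]
    omega

section

variable {b : ℕ} {p : ℕ → ℝ}

theorem hasSum_pos_part (hsum : HasSum p 1) :
    HasSum (fun i => (if i = 0 then (0 : ℝ) else 1) * p i) (1 - p 0) := by
  have h := (hasSum_ite_eq 0 (p 0)).neg.add hsum
  rw [neg_add_eq_sub] at h
  refine h.congr_fun fun i => ?_
  split_ifs with h0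
  · simp [h0]
  · simp

theorem sum_totalLength_le (hb : 2 ≤ b) (hp : ∀ i, 0 ≤ p i) (hsum : HasSum p 1)
    {P : ℕ → List (ℕ × ℕ)} (h : ∀ l, 1 ≤ l → HasDigitCounts b p l (P l)) (k : ℕ) :
    ((∑ l ∈ Finset.Icc 1 k, totalLength b l (P l) : ℕ) : ℝ) ≤ (1 - p 0) * (b : ℝ) ^ k := by
  have hp1 : ∀ i, p i ≤ 1 := fun i => le_hasSum hsum i fun j _ => hp j
  refine le_trans (le_of_eq ?_) (sum_length_le hb hp hp1 h k
    (fun i => if i = 0 then 0 else 1) (by simp) (fun i => by split_ifs <;> simp)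
    (hasSum_pos_part hsum))
  rw [Nat.cast_sum]
  refine Finset.sum_congr rfl fun l hl => ?_
  rw [totalLength, Nat.cast_list_sum, List.map_map]
  congr 1
  refine List.map_congr_left fun q hq => ?_
  have := ((h l (Finset.mem_Icc.1 hl).1).bounds_of_mem hq).1
  simp [show q.1 ≠ 0 by omega]

/-- The blocks can be selected one after the other without gaps, since those of the steps up to `k`
have total length at most `b ^ k`. -/
theorem exists_isSelection (hb : 2 ≤ b) (hp : ∀ i, 0 ≤ p i) (hsum : HasSum p 1) :
    ∃ S, IsSelection b p S := by
  choose P hP using exists_hasDigitCounts hb hp hsum.summable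
  let off : ℕ → ℕ := fun k => ∑ l ∈ Finset.Icc 1 k, totalLength b l (P l)
  have hoff : ∀ k, 1 ≤ k → off (k - 1) + totalLength b k (P k) = off k := by
    intro k hk
    obtain ⟨k, rfl⟩ := Nat.exists_eq_add_of_le' hk
    simp only [off, Nat.add_sub_cancel]
    rw [Finset.sum_Icc_succ_top (by omega)]
  have hle : ∀ k, off k ≤ b ^ k := by
    intro k
    have h1 := sum_totalLength_le hb hp hsum (fun l _ => hP l) k
    have h2 : (1 - p 0) * (b : ℝ) ^ k ≤ 1 * (b : ℝ) ^ k := by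
      gcongr
      linarith [hp 0]
    rw [one_mul] at h2
    exact_mod_cast h1.trans h2
  have hmono : Monotone off := fun k l hkl =>
    Finset.sum_le_sum_of_subset (Finset.Icc_subset_Icc_right hkl)
  have hpos : ∀ k, 1 ≤ k → ∀ m, (∃ β ∈ placeBlocks b k (off (k - 1)) (P k),
      m ∈ β.positions b k) ↔ off (k - 1) ≤ m ∧ m < off k := by
    intro k hk m
    rw [mem_positions_placeBlocks, hoff k hk]
  have hdisj : ∀ k l, 1 ≤ k → k < l → ∀ β ∈ placeBlocks b k (off (k - 1)) (P k),
      ∀ γ ∈ placeBlocks b l (off (l - 1)) (P l),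
      Disjoint (β.positions b k) (γ.positions b l) := by
    intro k l hk hkl β hβ γ hγ
    rw [Finset.disjoint_left]
    intro m hm hm'
    have h1 := (hpos k hk m).1 ⟨β, hβ, hm⟩
    have h2 := (hpos l (by omega) m).1 ⟨γ, hγ, hm'⟩
    have h3 : off k ≤ off (l - 1) := hmono (by omega)
    omega
  refine ⟨fun k => placeBlocks b k (off (k - 1)) (P k), ⟨fun k hk => ?_, fun k hk β hβ => ?_,
    fun k hk => ?_, fun k l hk hl hkl β hβ γ hγ => ?_, fun k hk _ => ⟨off k, fun m => ?_⟩⟩⟩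
  · rw [← hasDigitCounts_map_iff, map_placeBlocks]
    exact hP k
  · refine (bounds_of_mem_placeBlocks b k (P k) _ β hβ).2.trans ?_
    rw [hoff k hk]
    exact hle k
  · exact pairwise_placeBlocks b k (P k) _
  · rcases lt_or_gt_of_ne hkl with h | h
    · exact hdisj k l hk h β hβ γ hγ
    · exact (hdisj l k hl h γ hγ β hβ).symm
  · constructor
    · intro hm
      -- The step that covers the position `m` is the first one with `m < off l`.
      have hex : ∃ l, m < off l := ⟨k, hm⟩
      classical
      have h1 : Nat.find hex ≠ 0 := by
        intro h0
        have := Nat.find_spec hex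
        rw [h0] at this
        simp [off] at this
      refine ⟨Nat.find hex, by omega, Nat.find_min' hex hm,
        (hpos _ (by omega) m).2 ⟨?_, Nat.find_spec hex⟩⟩
      exact not_lt.1 (Nat.find_min hex (show Nat.find hex - 1 < Nat.find hex by omega))
    · rintro ⟨l, hl, hlk, hm⟩
      exact ((hpos l hl m).1 hm).2.trans_le (hmono hlk)

theorem IsSelection.hasDigitCounts {S : ℕ → List Block} (hS : IsSelection b p S) (l : ℕ)
    (hl : 1 ≤ l) : HasDigitCounts b p l ((S l).map fun β => (β.mult, β.level)) :=
  hasDigitCounts_map_iff.2 (hS.count l hl)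

theorem length_run {Ω : Type*} (A : ℕ → Ω) (b k : ℕ) (β : Block) :
    (β.run A b k).length = β.mult * β.len b k := by
  simp [Block.run, factor_length]

theorem length_output {Ω : Type*} (A : ℕ → Ω) (b : ℕ) (S : ℕ → List Block) (k : ℕ) :
    (output A b S k).length =
      ∑ l ∈ Finset.Icc 1 k, ((S l).map fun β => β.mult * β.len b l).sum := by
  induction k with
  | zero => rfl
  | succ k ih =>
    rw [Finset.sum_Icc_succ_top (by omega), ← ih, output, List.length_append, List.length_flatMap]
    simp only [length_run]

theorem length_output_cast {Ω : Type*} (A : ℕ → Ω) (b : ℕ) (S : ℕ → List Block) (k : ℕ) :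
    ((output A b S k).length : ℝ) = ∑ l ∈ Finset.Icc 1 k,
      (((S l).map fun β => (β.mult, β.level)).map
        fun q => (q.1 : ℝ) * (b : ℝ) ^ (l - q.2)).sum := by
  rw [length_output, Nat.cast_sum]
  refine Finset.sum_congr rfl fun l _ => ?_
  rw [Nat.cast_list_sum, List.map_map, List.map_map]
  congr 1
  refine List.map_congr_left fun β _ => ?_
  simp [Block.len]

theorem length_output_le {Ω : Type*} (A : ℕ → Ω) (hb : 2 ≤ b) (hp : ∀ i, 0 ≤ p i)
    (hsum : HasSum p 1) {lam : ℝ} (hmean : HasSum (fun i : ℕ => (i : ℝ) * p i) lam)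
    {S : ℕ → List Block} (hS : IsSelection b p S) (k : ℕ) :
    ((output A b S k).length : ℝ) ≤ lam * (b : ℝ) ^ k := by
  have hp1 : ∀ i, p i ≤ 1 := fun i => le_hasSum hsum i fun j _ => hp j
  rw [length_output_cast]
  exact sum_length_le hb hp hp1 hS.hasDigitCounts k (fun i => (i : ℝ)) (by simp)
    (fun i => Nat.cast_nonneg i) hmean

theorem tendsto_length_output {Ω : Type*} (A : ℕ → Ω) (hb : 2 ≤ b) (hp : ∀ i, 0 ≤ p i)
    (hsum : HasSum p 1) {lam : ℝ} (hlam : 0 < lam)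
    (hmean : HasSum (fun i : ℕ => (i : ℝ) * p i) lam)
    {S : ℕ → List Block} (hS : IsSelection b p S) :
    Tendsto (fun k => (output A b S k).length) atTop atTop := by
  have hp1 : ∀ i, p i ≤ 1 := fun i => le_hasSum hsum i fun j _ => hp j
  obtain ⟨i, hi⟩ : ∃ i : ℕ, (i : ℝ) * p i ≠ 0 := by
    by_contra! hno
    simp only [hno] at hmean
    exact hlam.ne' (hmean.unique hasSum_zero)
  have hpos : 0 < (i : ℝ) * p i :=
    lt_of_le_of_ne (mul_nonneg (Nat.cast_nonneg i) (hp i)) (Ne.symm hi)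
  have hb1 : (1 : ℝ) < b := by exact_mod_cast (by omega : 1 < b)
  have h1 : Tendsto (fun k => ((i : ℝ) * ((selectedLength b p k i : ℝ) / (b : ℝ) ^ k)) *
      (b : ℝ) ^ k) atTop atTop :=
    ((tendsto_selectedLength_div hb hp hp1 i).const_mul (i : ℝ)).pos_mul_atTop hpos
      (tendsto_pow_atTop_atTop_of_one_lt hb1)
  rw [← tendsto_natCast_atTop_iff (R := ℝ)]
  refine tendsto_atTop_mono (fun k => ?_) h1
  rw [length_output_cast, mul_assoc, div_mul_cancel₀ _ (by positivity)]
  exact le_sum_length hS.hasDigitCounts k (fun i => (i : ℝ)) (by simp)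
    (fun i => Nat.cast_nonneg i) i

end

/-- An increasing chain of words whose lengths tend to infinity has an infinite limit. -/
theorem exists_limit_of_prefix_chain {Ω : Type*} (u : ℕ → List Ω) (hu : ∀ k, u k <+: u (k + 1))
    (hlen : Tendsto (fun k => (u k).length) atTop atTop) :
    ∃ x : ℕ → Ω, ∀ k, u k = initSeg x (u k).length := by
  have hmono : ∀ k l, k ≤ l → u k <+: u l := by
    intro k l hkl
    induction l, hkl using Nat.le_induction with
    | base => exact List.prefix_rfl
    | succ l _ ih => exact ih.trans (hu l)
  choose K hK using fun n => (hlen.eventually_gt_atTop n).exists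
  refine ⟨fun n => (u (K n))[n]'(hK n), fun k => ?_⟩
  refine List.ext_getElem (initSeg_length _ _).symm fun n h1 h2 => ?_
  rw [initSeg_getElem]
  rcases le_total k (K n) with h | h
  · exact (hmono _ _ h).getElem h1
  · exact ((hmono _ _ h).getElem (hK n)).symm

theorem exists_isConstructed {Ω : Type*} [Fintype Ω] (hb : 2 ≤ Fintype.card Ω) {lam : ℝ}
    (hlam : 0 < lam) {p : ℕ → ℝ} (hp : ∀ i, 0 ≤ p i) (hsum : HasSum p 1)
    (hmean : HasSum (fun i : ℕ => (i : ℝ) * p i) lam) (A : ℕ → Ω) :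
    ∃ x : ℕ → Ω, IsConstructed p A x := by
  obtain ⟨S, hS⟩ := exists_isSelection hb hp hsum
  have hlen := tendsto_length_output A hb hp hsum hlam hmean hS
  obtain ⟨x, hx⟩ := exists_limit_of_prefix_chain (output A (Fintype.card Ω) S)
    (fun k => List.prefix_append _ _) hlen
  exact ⟨x, S, hS, hlen, hx⟩

/-! ### Occurrences in concatenations -/

theorem initSeg_add {Ω : Type*} (x : ℕ → Ω) (m n : ℕ) :
    initSeg x (m + n) = initSeg x m ++ factor x m n := by
  unfold initSeg factor
  rw [List.range_add]
  simp

section occurrences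

variable {Ω : Type*} [DecidableEq Ω]

theorem occ_add_occ_le_occ_append (v u w : List Ω) (hw : 1 ≤ w.length) :
    occ v w + occ u w ≤ occ (v ++ u) w := by
  unfold occ
  rw [← Finset.card_map (addLeftEmbedding v.length)
    (s := (Finset.range (u.length + 1)).filter _), ← Finset.card_union_of_disjoint]
  · refine Finset.card_le_card fun s hs => ?_
    simp only [Finset.mem_union, Finset.mem_filter, Finset.mem_range, Finset.mem_map,
      addLeftEmbedding_apply, List.length_append] at hs ⊢
    rcases hs with ⟨h1, h2, h3⟩ | ⟨t, ⟨h1, h2, h3⟩, rfl⟩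
    · refine ⟨by omega, by omega, ?_⟩
      rw [List.drop_append_of_le_length (by omega),
        List.take_append_of_le_length (by rw [List.length_drop]; omega), h3]
    · refine ⟨by omega, by omega, ?_⟩
      rw [List.drop_append, List.drop_eq_nil_of_le (by omega), List.nil_append,
        Nat.add_sub_cancel_left, h3]
  · rw [Finset.disjoint_left]
    intro s hs hs'
    simp only [Finset.mem_filter, Finset.mem_range, Finset.mem_map, addLeftEmbedding_apply]
      at hs hs'
    obtain ⟨t, -, rfl⟩ := hs'
    omega

theorem occ_le_occ_flatMap {α : Type*} (f : α → List Ω) {L : List α} {a : α} (ha : a ∈ L)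
    (w : List Ω) (hw : 1 ≤ w.length) : occ (f a) w ≤ occ (L.flatMap f) w := by
  obtain ⟨L₁, L₂, rfl⟩ := List.append_of_mem ha
  rw [List.flatMap_append, List.flatMap_cons]
  have h1 := occ_add_occ_le_occ_append (L₁.flatMap f) (f a ++ L₂.flatMap f) w hw
  have h2 := occ_add_occ_le_occ_append (f a) (L₂.flatMap f) w hw
  omega

theorem mul_occ_le_occ_replicate (m : ℕ) (v w : List Ω) (hw : 1 ≤ w.length) :
    m * occ v w ≤ occ (List.replicate m v).flatten w := by
  induction m with
  | zero => simp
  | succ m ih =>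
    rw [List.replicate_succ, List.flatten_cons]
    have := occ_add_occ_le_occ_append v (List.replicate m v).flatten w hw
    rw [add_mul, one_mul]
    omega

theorem occ_initSeg_mono (x : ℕ → Ω) {m n : ℕ} (hmn : m ≤ n) (w : List Ω) (hw : 1 ≤ w.length) :
    occ (initSeg x m) w ≤ occ (initSeg x n) w := by
  obtain ⟨d, rfl⟩ := Nat.exists_eq_add_of_le hmn
  rw [initSeg_add]
  have := occ_add_occ_le_occ_append (initSeg x m) (factor x m d) w hw
  omega

theorem one_le_occ_factor (A : ℕ → Ω) {a n s k : ℕ} (h1 : a ≤ s) (h2 : s + k ≤ a + n) :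
    1 ≤ occ (factor A a n) (factor A s k) := by
  refine Finset.card_pos.2 ⟨s - a, ?_⟩
  simp only [Finset.mem_filter, Finset.mem_range, factor_length]
  refine ⟨by omega, by omega, ?_⟩
  apply List.ext_getElem
  · simp only [List.length_take, List.length_drop, factor_length]; omega
  · intro i h3 h4
    rw [List.getElem_take, List.getElem_drop, factor_getElem, factor_getElem]
    congr 1; omega

theorem sum_occ_le [Fintype Ω] (v : List Ω) (k : ℕ) :
    ∑ w : Fin k → Ω, occ v (List.ofFn w) ≤ v.length + 1 - k := by
  unfold occ
  rw [← Finset.card_biUnion]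
  · conv_rhs => rw [← Finset.card_range (v.length + 1 - k)]
    refine Finset.card_le_card fun s hs => ?_
    simp only [Finset.mem_biUnion, Finset.mem_filter, Finset.mem_range, List.length_ofFn] at hs ⊢
    obtain ⟨w, -, -, h, -⟩ := hs
    omega
  · intro w _ w' _ hne
    rw [Function.onFun, Finset.disjoint_left]
    intro s hs hs'
    simp only [Finset.mem_filter, List.length_ofFn] at hs hs'
    exact hne (List.ofFn_injective (hs.2.2.symm.trans hs'.2.2))

theorem occ_run_le_occ_output (A : ℕ → Ω) (b : ℕ) (S : ℕ → List Block) {k l : ℕ} (hl : 1 ≤ l)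
    (hlk : l ≤ k) {β : Block} (hβ : β ∈ S l) (w : List Ω) (hw : 1 ≤ w.length) :
    occ (β.run A b l) w ≤ occ (output A b S k) w := by
  induction k, hlk using Nat.le_induction with
  | base =>
    obtain ⟨l, rfl⟩ := Nat.exists_eq_add_of_le' hl
    have h1 := occ_le_occ_flatMap (fun β => β.run A b (l + 1)) hβ w hw
    have h2 := occ_add_occ_le_occ_append (output A b S l)
      ((S (l + 1)).flatMap fun β => β.run A b (l + 1)) w hw
    rw [output]
    omega
  | succ k _ ih =>
    have h2 := occ_add_occ_le_occ_append (output A b S k)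
      ((S (k + 1)).flatMap fun β => β.run A b (k + 1)) w hw
    rw [output]
    omega

end occurrences

/-! ### Words inside the selected blocks -/

open Classical in
/-- The positions `s` such that the word of length `k` starting there lies inside a block of
multiplicity `i` selected in one of the steps up to `k`. -/
noncomputable def startSet (b : ℕ) (S : ℕ → List Block) (k i : ℕ) : Finset ℕ :=
  (Finset.Icc 1 k).biUnion fun l => ((S l).filter fun β => β.mult = i).toFinset.biUnion fun β =>
    Finset.Ico β.start (β.start + (β.len b l + 1 - k))

theorem mem_startSet {b : ℕ} {S : ℕ → List Block} {k i s : ℕ} :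
    s ∈ startSet b S k i ↔ ∃ l, 1 ≤ l ∧ l ≤ k ∧ ∃ β ∈ S l, β.mult = i ∧ β.start ≤ s ∧
      s + k ≤ β.start + β.len b l := by
  simp only [startSet, Finset.mem_biUnion, Finset.mem_Icc, List.mem_toFinset, List.mem_filter,
    Finset.mem_Ico, decide_eq_true_eq, and_assoc]
  refine exists_congr fun l => and_congr_right fun _ => and_congr_right fun _ =>
    exists_congr fun β => and_congr_right fun _ => and_congr_right fun _ => ?_
  omega

section

variable {b : ℕ} {p : ℕ → ℝ} {S : ℕ → List Block}

theorem IsSelection.nodup (hb : 2 ≤ b) (hS : IsSelection b p S) {l : ℕ} (hl : 1 ≤ l) :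
    (S l).Nodup := by
  refine (hS.disjoint_same l hl).imp ?_
  rintro β γ h rfl
  have hpos : 0 < b ^ (l - β.level) := by positivity
  rw [disjoint_self, Finset.bot_eq_empty, Block.positions, Block.len,
    Finset.Ico_eq_empty_iff] at h
  omega

theorem IsSelection.eq_of_mem_positions (hS : IsSelection b p S) {l l' : ℕ} (hl : 1 ≤ l)
    (hl' : 1 ≤ l') {β γ : Block} (hβ : β ∈ S l) (hγ : γ ∈ S l') {m : ℕ}
    (hm : m ∈ β.positions b l) (hm' : m ∈ γ.positions b l') : l = l' ∧ β = γ := by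
  have hll : l = l' := by
    by_contra hne
    exact Finset.disjoint_left.1 (hS.disjoint_diff l l' hl hl' hne β hβ γ hγ) hm hm'
  subst hll
  refine ⟨rfl, ?_⟩
  by_contra hne
  have hsymm : Std.Symm fun β γ : Block => Disjoint (β.positions b l) (γ.positions b l) :=
    ⟨fun _ _ h => h.symm⟩
  exact Finset.disjoint_left.1 ((hS.disjoint_same l hl).forall hβ hγ hne) hm hm'

theorem Ico_subset_positions {β : Block} {k l : ℕ} (hk : 1 ≤ k) :
    Finset.Ico β.start (β.start + (β.len b l + 1 - k)) ⊆ β.positions b l := by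
  refine Finset.Ico_subset_Ico_right ?_
  omega

theorem disjoint_startSet (hS : IsSelection b p S) {k i j : ℕ} (hk : 1 ≤ k) (hij : i ≠ j) :
    Disjoint (startSet b S k i) (startSet b S k j) := by
  rw [Finset.disjoint_left]
  intro s hs hs'
  obtain ⟨l, hl, -, β, hβ, rfl, h1, h2⟩ := mem_startSet.1 hs
  obtain ⟨l', hl', -, γ, hγ, rfl, h3, h4⟩ := mem_startSet.1 hs'
  have hm : s ∈ β.positions b l := Finset.mem_Ico.2 ⟨h1, by omega⟩
  have hm' : s ∈ γ.positions b l' := Finset.mem_Ico.2 ⟨h3, by omega⟩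
  exact hij (by rw [(hS.eq_of_mem_positions hl hl' hβ hγ hm hm').2])

theorem card_startSet (hb : 2 ≤ b) (hS : IsSelection b p S) {k : ℕ} (hk : 1 ≤ k) (i : ℕ) :
    (startSet b S k i).card = ∑ l ∈ Finset.Icc 1 k,
      ((S l).map fun β => if β.mult = i then β.len b l + 1 - k else 0).sum := by
  classical
  unfold startSet
  rw [Finset.card_biUnion]
  · refine Finset.sum_congr rfl fun l hl => ?_
    have hl1 := (Finset.mem_Icc.1 hl).1
    rw [Finset.card_biUnion]
    · rw [List.sum_toFinset _ ((hS.nodup hb hl1).filter _)]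
      induction S l with
      | nil => rfl
      | cons β L ih =>
        by_cases h : β.mult = i
        · simpa [List.filter_cons, h] using ih
        · simpa [List.filter_cons, h] using ih
    · intro β hβ γ hγ hne
      simp only [Finset.mem_coe, List.mem_toFinset, List.mem_filter] at hβ hγ
      rw [Function.onFun, Finset.disjoint_left]
      intro s hs hs'
      exact hne (hS.eq_of_mem_positions hl1 hl1 hβ.1 hγ.1 (Ico_subset_positions hk hs)
        (Ico_subset_positions hk hs')).2
  · intro l hl l' hl' hne
    rw [Function.onFun, Finset.disjoint_left]
    intro s hs hs'
    simp only [Finset.mem_biUnion, List.mem_toFinset, List.mem_filter] at hs hs'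
    obtain ⟨β, hβ, hs⟩ := hs
    obtain ⟨γ, hγ, hs'⟩ := hs'
    exact hne (hS.eq_of_mem_positions (Finset.mem_Icc.1 hl).1 (Finset.mem_Icc.1 hl').1 hβ.1 hγ.1
      (Ico_subset_positions hk hs) (Ico_subset_positions hk hs')).1

theorem card_startSet_cast (hb : 2 ≤ b) (hS : IsSelection b p S) {k : ℕ} (hk : 1 ≤ k) {i : ℕ}
    (hi : 1 ≤ i) :
    ((startSet b S k i).card : ℝ) = ∑ l ∈ Finset.Icc 1 k, ∑ j ∈ Finset.Icc 1 (g l),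
      (digit b (stepNumber b p l i) j : ℝ) * ((b ^ (l - j) + 1 - k : ℕ) : ℝ) := by
  obtain ⟨F, hiF, hF⟩ := exists_finset_fst (fun l => (S l).map fun β => (β.mult, β.level)) k i
  rw [card_startSet hb hS hk, Nat.cast_sum]
  refine Finset.sum_congr rfl fun l hl => ?_
  have h := (hS.hasDigitCounts l (Finset.mem_Icc.1 hl).1).sum_map F (hF l hl)
    (fun i' j => if i' = i then ((b ^ (l - j) + 1 - k : ℕ) : ℝ) else 0)
    (fun j => if_neg (by omega))
  rw [Finset.sum_eq_single_of_mem i hiF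
    (fun i' _ hne => by simp only [if_neg hne, mul_zero, Finset.sum_const_zero])] at h
  simp only [if_true] at h
  rw [← h, List.map_map, Nat.cast_list_sum, List.map_map]
  congr 1
  refine List.map_congr_left fun β _ => ?_
  simp only [Function.comp_apply, Block.len]
  split_ifs <;> simp

theorem card_startSet_le (hb : 2 ≤ b) (hS : IsSelection b p S) {k : ℕ} (hk : 1 ≤ k) {i : ℕ}
    (hi : 1 ≤ i) : ((startSet b S k i).card : ℝ) ≤ selectedLength b p k i := by
  rw [card_startSet_cast hb hS hk hi, selectedLength, Nat.cast_sum]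
  refine Finset.sum_le_sum fun l _ => ?_
  rw [stepLength, Nat.cast_sum]
  refine Finset.sum_le_sum fun j _ => ?_
  rw [Nat.cast_mul]
  gcongr
  omega

/-- Only `k - 1` starting positions are lost at the end of each block. -/
theorem le_card_startSet (hb : 2 ≤ b) (hS : IsSelection b p S) {k : ℕ} (hk : 1 ≤ k) {i : ℕ}
    (hi : 1 ≤ i) :
    (selectedLength b p k i : ℝ) - k * (k * k * b) ≤ (startSet b S k i).card := by
  have h1 : ((∑ l ∈ Finset.Icc 1 k, ∑ j ∈ Finset.Icc 1 (g l),
      digit b (stepNumber b p l i) j : ℕ) : ℝ) ≤ ((k * k * b : ℕ) : ℝ) :=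
    Nat.cast_le.2 (sum_sum_digit_le hb p k i)
  push_cast at h1
  refine (sub_le_sub_left (mul_le_mul_of_nonneg_left h1 (Nat.cast_nonneg k)) _).trans ?_
  rw [card_startSet_cast hb hS hk hi, selectedLength, Nat.cast_sum, Finset.mul_sum,
    ← Finset.sum_sub_distrib]
  refine Finset.sum_le_sum fun l _ => ?_
  rw [stepLength, Nat.cast_sum, Finset.mul_sum, ← Finset.sum_sub_distrib]
  refine Finset.sum_le_sum fun j _ => ?_
  have h2 : ((b ^ (l - j) : ℕ) : ℝ) ≤ ((b ^ (l - j) + 1 - k : ℕ) : ℝ) + k := by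
    rw [← Nat.cast_add]
    exact Nat.cast_le.2 (by omega)
  have h3 : (0 : ℝ) ≤ digit b (stepNumber b p l i) j := Nat.cast_nonneg _
  rw [Nat.cast_mul]
  nlinarith

theorem tendsto_card_startSet_div (hb : 2 ≤ b) (hp : ∀ i, 0 ≤ p i) (hp1 : ∀ i, p i ≤ 1)
    (hS : IsSelection b p S) {i : ℕ} (hi : 1 ≤ i) :
    Tendsto (fun k => ((startSet b S k i).card : ℝ) / (b : ℝ) ^ k) atTop (𝓝 (p i)) := by
  have hb0 : (0 : ℝ) < b := by positivity
  have hb1 : (1 : ℝ) < b := by exact_mod_cast (by omega : 1 < b)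
  have h1 := tendsto_selectedLength_div hb hp hp1 i
  have h2 : Tendsto (fun k : ℕ => (k : ℝ) ^ 3 / (b : ℝ) ^ k * b) atTop (𝓝 0) := by
    simpa using (tendsto_pow_const_div_const_pow_of_one_lt 3 hb1).mul_const (b : ℝ)
  refine tendsto_of_tendsto_of_tendsto_of_le_of_le' (by simpa using h1.sub h2) h1 ?_ ?_
  · filter_upwards [eventually_ge_atTop 1] with k hk
    have h3 := le_card_startSet hb hS hk hi
    rw [le_div_iff₀ (by positivity), sub_mul, div_mul_cancel₀ _ (by positivity)]
    refine le_trans (le_of_eq ?_) h3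
    field_simp
  · filter_upwards [eventually_ge_atTop 1] with k hk
    refine div_le_div_of_nonneg_right ?_ (by positivity)
    exact card_startSet_le hb hS hk hi

end

/-! ### Words in the selected blocks are pairwise distinct -/

theorem IsCyclicDeBruijn.eq_of_agree {Ω : Type*} [Fintype Ω] {n N : ℕ} {A : ℕ → Ω}
    (h : IsCyclicDeBruijn n (initSeg A N)) (hn : 1 ≤ n) {s t : ℕ} (hs : s + n ≤ N)
    (ht : t + n ≤ N) (hst : ∀ i < n, A (s + i) = A (t + i)) : s = t := by
  have key : ∀ s, s + n ≤ N → ((initSeg A N).rotate s).take n = factor A s n := by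
    intro s hs
    apply List.ext_getElem
    · simp only [List.length_take, List.length_rotate, initSeg_length, factor_length]; omega
    · intro i h1 h2
      rw [factor_length] at h2
      simp only [List.getElem_take, List.getElem_rotate, initSeg_getElem, initSeg_length,
        factor_getElem]
      rw [Nat.mod_eq_of_lt (by omega), add_comm]
  refine (h.2 (factor A s n) (factor_length _ _ _)).unique ⟨?_, key s hs⟩ ⟨?_, ?_⟩
  · rw [initSeg_length]; omega
  · rw [initSeg_length]; omega
  · rw [key t ht]
    apply List.ext_getElem
    · rw [factor_length, factor_length]
    · intro i h1 h2
      rw [factor_length] at h1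
      rw [factor_getElem, factor_getElem, hst i h1]

theorem card_le_sum_of_cover {α β : Type*} [DecidableEq β] (L : List α) (f : α → Finset β)
    (X : Finset β) (hX : ∀ m ∈ X, ∃ a ∈ L, m ∈ f a) : X.card ≤ (L.map fun a => (f a).card).sum := by
  induction L generalizing X with
  | nil =>
    rw [Finset.card_eq_zero.2 (Finset.eq_empty_of_forall_notMem fun m hm => by
      obtain ⟨a, ha, -⟩ := hX m hm
      simp at ha)]
    exact Nat.zero_le _
  | cons a L ih =>
    rw [List.map_cons, List.sum_cons]
    have h1 := ih (X \ f a) fun m hm => by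
      rw [Finset.mem_sdiff] at hm
      obtain ⟨c, hc, hmc⟩ := hX m hm.1
      rcases List.mem_cons.1 hc with rfl | hc
      · exact absurd hmc hm.2
      · exact ⟨c, hc, hmc⟩
    have h2 := Finset.card_le_card_sdiff_add_card (s := X) (t := f a)
    omega

/-- If the blocks of the steps up to `k` fill an initial segment of `A`, the length of that segment
is at most `(1 - p 0) b ^ k`. -/
theorem IsSelection.filled_le {b : ℕ} {p : ℕ → ℝ} {S : ℕ → List Block} (hb : 2 ≤ b)
    (hp : ∀ i, 0 ≤ p i) (hsum : HasSum p 1) (hS : IsSelection b p S) {k n : ℕ}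
    (hn : ∀ m < n, ∃ l, 1 ≤ l ∧ l ≤ k ∧ ∃ β ∈ S l, m ∈ β.positions b l) :
    (n : ℝ) ≤ (1 - p 0) * (b : ℝ) ^ k := by
  classical
  refine le_trans (Nat.cast_le.2 ?_) (sum_totalLength_le hb hp hsum hS.hasDigitCounts k)
  let X : ℕ → Finset ℕ := fun l =>
    (Finset.range n).filter fun m => ∃ β ∈ S l, m ∈ β.positions b l
  have h1 : Finset.range n ⊆ (Finset.Icc 1 k).biUnion X := by
    intro m hm
    obtain ⟨l, h1, h2, hβ⟩ := hn m (Finset.mem_range.1 hm)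
    exact Finset.mem_biUnion.2 ⟨l, Finset.mem_Icc.2 ⟨h1, h2⟩, Finset.mem_filter.2 ⟨hm, hβ⟩⟩
  have h2 := (Finset.card_le_card h1).trans Finset.card_biUnion_le
  rw [Finset.card_range] at h2
  refine h2.trans (Finset.sum_le_sum fun l _ => ?_)
  refine (card_le_sum_of_cover (S l) (fun β => β.positions b l) (X l)
    fun m hm => (Finset.mem_filter.1 hm).2).trans (le_of_eq ?_)
  rw [totalLength, List.map_map]
  congr 1
  refine List.map_congr_left fun β _ => ?_
  simp [Block.positions, Block.len]

/-- Over two symbols and for even `k`, the initial segment of length `2 ^ k` of `A` is not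
a de Bruijn word. But since no gaps are left and `p 0 ≥ 1 / 2`, the blocks of the steps up to `k`
lie in its first half, which is a de Bruijn word of order `k - 1`. -/
theorem eq_of_factor_eq {Ω : Type*} [Fintype Ω] (hb : 2 ≤ Fintype.card Ω) {p : ℕ → ℝ}
    (hp : ∀ i, 0 ≤ p i) (hsum : HasSum p 1) (h2 : Fintype.card Ω = 2 → 1 / 2 ≤ p 0)
    {A : ℕ → Ω} (hA : IsInfiniteDeBruijn A) {S : ℕ → List Block}
    (hS : IsSelection (Fintype.card Ω) p S) {k i j s t : ℕ} (hk : 1 ≤ k)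
    (hs : s ∈ startSet (Fintype.card Ω) S k i) (ht : t ∈ startSet (Fintype.card Ω) S k j)
    (hst : ∀ m < k, A (s + m) = A (t + m)) : s = t := by
  have hle : ∀ {i s}, s ∈ startSet (Fintype.card Ω) S k i → s + k ≤ Fintype.card Ω ^ k := by
    intro i s hs
    obtain ⟨l, hl, hlk, β, hβ, -, -, h⟩ := mem_startSet.1 hs
    exact h.trans ((hS.inside l hl β hβ).trans (Nat.pow_le_pow_right (by omega) hlk))
  by_cases h3 : 3 ≤ Fintype.card Ω
  · exact (hA.1 h3 k hk).eq_of_agree hk (hle hs) (hle ht) hst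
  have hc2 : Fintype.card Ω = 2 := by omega
  rw [hc2] at hs ht hle hS
  rcases Nat.even_or_odd k with ⟨q, hq⟩ | ⟨q, hq⟩
  · obtain ⟨n, hn⟩ := hS.no_gap k hk (Or.inr rfl)
    have hnle : n ≤ 2 ^ (2 * q - 1) := by
      have h4 := hS.filled_le le_rfl hp hsum fun m hm => (hn m).1 hm
      have h5 : ((2 : ℕ) : ℝ) ^ k = 2 * 2 ^ (2 * q - 1) := by
        rw [← pow_succ', show 2 * q - 1 + 1 = k by omega]; simp
      have h6 : (1 - p 0) * ((2 : ℕ) : ℝ) ^ k ≤ 2 ^ (2 * q - 1) := by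
        rw [h5]
        nlinarith [h2 hc2, show (0 : ℝ) < 2 ^ (2 * q - 1) by positivity]
      exact_mod_cast h4.trans h6
    have hlen : ∀ {i s}, s ∈ startSet 2 S k i → s + k ≤ n := by
      intro i s hs
      obtain ⟨l, hl, hlk, β, hβ, -, h7, h8⟩ := mem_startSet.1 hs
      have := (hn (s + k - 1)).2 ⟨l, hl, hlk, β, hβ, Finset.mem_Ico.2 ⟨by omega, by omega⟩⟩
      omega
    have h9 := hlen hs
    have h10 := hlen ht
    exact (hA.2 hc2 q (by omega)).eq_of_agree (by omega) (by omega) (by omega)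
      fun m hm => hst m (by omega)
  · have h4 := hA.2 hc2 (q + 1) (by omega)
    rw [show 2 * (q + 1) - 1 = k by omega] at h4
    exact h4.eq_of_agree hk (hle hs) (hle ht) hst

/-! ### Counting -/

/-- If `N ≥ i` on each of the disjoint sets `U i`, `1 ≤ i < M`, then `N` equals `i` exactly on `U i`
and vanishes outside all of them, up to a number of exceptions bounded by the excess of `∑ N`. -/
theorem abs_card_sub_le_excess {W : Type*} [Fintype W] [DecidableEq W] (N : W → ℕ)
    (U : ℕ → Finset W) (M : ℕ)
    (hU : ∀ i ∈ Finset.Ico 1 M, ∀ j ∈ Finset.Ico 1 M, i ≠ j → Disjoint (U i) (U j))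
    (hN : ∀ i ∈ Finset.Ico 1 M, ∀ w ∈ U i, i ≤ N w) :
    (∀ i ∈ Finset.Ico 1 M,
      |((Finset.univ.filter fun w => N w = i).card : ℝ) - (U i).card| ≤
        (∑ w, N w : ℕ) - ∑ j ∈ Finset.Ico 1 M, (j : ℝ) * (U j).card) ∧
    |((Finset.univ.filter fun w => N w = 0).card : ℝ) -
        (Fintype.card W - ∑ j ∈ Finset.Ico 1 M, ((U j).card : ℝ))| ≤
      (∑ w, N w : ℕ) - ∑ j ∈ Finset.Ico 1 M, (j : ℝ) * (U j).card := by
  let f : W → ℕ := fun w => ∑ j ∈ Finset.Ico 1 M, if w ∈ U j then j else 0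
  have hfU : ∀ i ∈ Finset.Ico 1 M, ∀ w ∈ U i, f w = i := by
    intro i hi w hw
    simp only [f]
    rw [Finset.sum_eq_single_of_mem i hi, if_pos hw]
    intro j hj hji
    rw [if_neg]
    exact fun hw' => Finset.disjoint_left.1 (hU j hj i hi hji) hw' hw
  have hf0 : ∀ w, (∀ i ∈ Finset.Ico 1 M, w ∉ U i) → f w = 0 := by
    intro w hw
    exact Finset.sum_eq_zero fun j hj => if_neg (hw j hj)
  have hfN : ∀ w, f w ≤ N w := by
    intro w
    by_cases h : ∃ i ∈ Finset.Ico 1 M, w ∈ U i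
    · obtain ⟨i, hi, hw⟩ := h
      rw [hfU i hi w hw]
      exact hN i hi w hw
    · push Not at h
      rw [hf0 w h]
      exact Nat.zero_le _
  have hfsum : ((∑ w, f w : ℕ) : ℝ) = ∑ j ∈ Finset.Ico 1 M, (j : ℝ) * (U j).card := by
    simp only [f]
    rw [Finset.sum_comm, Nat.cast_sum]
    refine Finset.sum_congr rfl fun j _ => ?_
    rw [Finset.sum_ite_mem, Finset.univ_inter, Finset.sum_const, smul_eq_mul, mul_comm]
    push_cast; rfl
  have hexc : ((Finset.univ.filter fun w => N w ≠ f w).card : ℝ) ≤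
      (∑ w, N w : ℕ) - ∑ j ∈ Finset.Ico 1 M, (j : ℝ) * (U j).card := by
    rw [← hfsum, le_sub_iff_add_le]
    norm_cast
    rw [Finset.card_filter, ← Finset.sum_add_distrib]
    refine Finset.sum_le_sum fun w _ => ?_
    have := hfN w
    split_ifs <;> omega
  have hcmp : ∀ i, |((Finset.univ.filter fun w => N w = i).card : ℝ) -
      (Finset.univ.filter fun w => f w = i).card| ≤
      ((Finset.univ.filter fun w => N w ≠ f w).card : ℝ) := by
    intro i
    have h1 : (Finset.univ.filter fun w => N w = i).card ≤
        (Finset.univ.filter fun w => f w = i).card +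
          (Finset.univ.filter fun w => N w ≠ f w).card := by
      refine (Finset.card_le_card fun w hw => ?_).trans (Finset.card_union_le _ _)
      simp only [Finset.mem_union, Finset.mem_filter, Finset.mem_univ, true_and] at hw ⊢
      omega
    have h2 : (Finset.univ.filter fun w => f w = i).card ≤
        (Finset.univ.filter fun w => N w = i).card +
          (Finset.univ.filter fun w => N w ≠ f w).card := by
      refine (Finset.card_le_card fun w hw => ?_).trans (Finset.card_union_le _ _)
      simp only [Finset.mem_union, Finset.mem_filter, Finset.mem_univ, true_and] at hw ⊢
      omega
    rw [abs_le]
    constructor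
    · have : ((Finset.univ.filter fun w => f w = i).card : ℝ) ≤
        (Finset.univ.filter fun w => N w = i).card +
          (Finset.univ.filter fun w => N w ≠ f w).card := by exact_mod_cast h2
      linarith
    · have : ((Finset.univ.filter fun w => N w = i).card : ℝ) ≤
        (Finset.univ.filter fun w => f w = i).card +
          (Finset.univ.filter fun w => N w ≠ f w).card := by exact_mod_cast h1
      linarith
  refine ⟨fun i hi => ?_, ?_⟩
  · have h1 : (Finset.univ.filter fun w => f w = i) = U i := by
      ext w
      simp only [Finset.mem_filter, Finset.mem_univ, true_and]
      refine ⟨fun hw => ?_, hfU i hi w⟩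
      have hi1 := (Finset.mem_Ico.1 hi).1
      by_contra hwi
      by_cases h : ∃ j ∈ Finset.Ico 1 M, w ∈ U j
      · obtain ⟨j, hj, hwj⟩ := h
        rw [hfU j hj w hwj] at hw
        exact hwi (hw ▸ hwj)
      · push Not at h
        rw [hf0 w h] at hw
        omega
    rw [← h1]
    exact (hcmp i).trans hexc
  · have h1 : (Finset.univ.filter fun w => f w = 0) = ((Finset.Ico 1 M).biUnion U)ᶜ := by
      ext w
      simp only [Finset.mem_filter, Finset.mem_univ, true_and, Finset.mem_compl,
        Finset.mem_biUnion, not_exists, not_and]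
      refine ⟨fun hw i hi hwi => ?_, hf0 w⟩
      rw [hfU i hi w hwi] at hw
      have := (Finset.mem_Ico.1 hi).1
      omega
    have h2 : ((Finset.univ.filter fun w => f w = 0).card : ℝ) =
        Fintype.card W - ∑ j ∈ Finset.Ico 1 M, ((U j).card : ℝ) := by
      rw [h1, Finset.card_compl, Nat.cast_sub (Finset.card_le_univ _),
        Finset.card_biUnion (fun i hi j hj hij => hU i hi j hj hij), Nat.cast_sum]
    rw [← h2]
    exact (hcmp 0).trans hexc

/-- Limits in two parameters: an approximation whose error vanishes in the iterated limit. -/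
theorem tendsto_of_approx {z : ℕ → ℝ} {t e : ℕ → ℕ → ℝ} {t' e' : ℕ → ℝ} {c : ℝ}
    (h : ∀ᶠ M in atTop, ∀ᶠ k in atTop, |z k - t M k| ≤ e M k)
    (ht : ∀ᶠ M in atTop, Tendsto (t M) atTop (𝓝 (t' M)))
    (he : ∀ M, Tendsto (e M) atTop (𝓝 (e' M)))
    (ht' : Tendsto t' atTop (𝓝 c)) (he' : Tendsto e' atTop (𝓝 0)) :
    Tendsto z atTop (𝓝 c) := by
  rw [Metric.tendsto_nhds]
  intro ε hε
  obtain ⟨M, h1, h2, h3, h4⟩ := (h.and (ht.and ((he'.eventually_lt_const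
    (show (0 : ℝ) < ε / 3 by linarith)).and
    (Metric.tendsto_nhds.1 ht' (ε / 3) (by linarith))))).exists
  filter_upwards [h1, (he M).eventually_lt_const h3,
    Metric.tendsto_nhds.1 h2 (ε / 3) (by linarith)] with k h5 h6 h7
  rw [Real.dist_eq] at *
  rw [abs_lt] at *
  rw [abs_le] at h5
  constructor <;> linarith

/-- The words of length `k` inside the selected blocks of multiplicity `i` occur at least `i` times
in the sequence, and the number of all occurrences leaves little room for further ones. -/
theorem tendsto_Z {Ω : Type*} [Fintype Ω] [DecidableEq Ω] (hb : 2 ≤ Fintype.card Ω)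
    {lam : ℝ} (hlam : 0 < lam) {p : ℕ → ℝ} (hp : ∀ i, 0 ≤ p i)
    (hsum : HasSum p 1) (hmean : HasSum (fun i : ℕ => (i : ℝ) * p i) lam)
    (h2 : Fintype.card Ω = 2 → 1 / 2 ≤ p 0) {A x : ℕ → Ω} (hA : IsInfiniteDeBruijn A)
    (hx : IsConstructed p A x) (i : ℕ) :
    Tendsto (fun k : ℕ => Z lam i k x) atTop (𝓝 (p i)) := by
  obtain ⟨S, hS, -, hout⟩ := hx
  have hp1 : ∀ i, p i ≤ 1 := fun i => le_hasSum hsum i fun j _ => hp j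
  set b := Fintype.card Ω with hbdef
  have hb0 : (0 : ℝ) < b := by positivity
  let v : ℕ → List Ω := fun k => initSeg x (⌊lam * (b : ℝ) ^ k⌋₊ + k - 1)
  let N : (k : ℕ) → (Fin k → Ω) → ℕ := fun k w => occ (v k) (List.ofFn w)
  let U : (k : ℕ) → ℕ → Finset (Fin k → Ω) := fun k j =>
    (startSet b S k j).image (window k A)
  let q : ℕ → ℕ → ℝ := fun k j => ((startSet b S k j).card : ℝ) / (b : ℝ) ^ k
  have hinj : ∀ k, 1 ≤ k → ∀ i j s t, s ∈ startSet b S k i → t ∈ startSet b S k j →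
      window k A s = window k A t → s = t := fun k hk i j s t hs ht hst =>
    eq_of_factor_eq hb hp hsum h2 hA hS hk hs ht fun m hm => congrFun hst ⟨m, hm⟩
  have hUcard : ∀ k, 1 ≤ k → ∀ j, (U k j).card = (startSet b S k j).card := fun k hk j =>
    Finset.card_image_of_injOn fun s hs t ht => hinj k hk j j s t hs ht
  have hUdisj : ∀ k, 1 ≤ k → ∀ i j, i ≠ j → Disjoint (U k i) (U k j) := by
    intro k hk i j hij
    rw [Finset.disjoint_left]
    intro w hw hw'
    obtain ⟨s, hs, rfl⟩ := Finset.mem_image.1 hw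
    obtain ⟨t, ht, hst⟩ := Finset.mem_image.1 hw'
    have := hinj k hk i j s t hs ht hst.symm
    subst this
    exact Finset.disjoint_left.1 (disjoint_startSet hS hk hij) hs ht
  have hNge : ∀ k, 1 ≤ k → ∀ j, ∀ w ∈ U k j, j ≤ N k w := by
    intro k hk j w hw
    obtain ⟨s, hs, rfl⟩ := Finset.mem_image.1 hw
    obtain ⟨l, hl, hlk, β, hβ, rfl, h3, h4⟩ := mem_startSet.1 hs
    have hfac : List.ofFn (window k A s) = factor A s k := by
      apply List.ext_getElem
      · simp [factor_length]
      · intro m h5 h6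
        simp [window, factor_getElem]
    have hwlen : 1 ≤ (factor A s k).length := by rwa [factor_length]
    have hL : (output A b S k).length ≤ ⌊lam * (b : ℝ) ^ k⌋₊ :=
      Nat.le_floor (length_output_le A hb hp hsum hmean hS k)
    calc β.mult ≤ β.mult * occ (factor A β.start (β.len b l)) (factor A s k) :=
          Nat.le_mul_of_pos_right _ (one_le_occ_factor A h3 h4)
      _ ≤ occ (β.run A b l) (factor A s k) := mul_occ_le_occ_replicate _ _ _ hwlen
      _ ≤ occ (output A b S k) (factor A s k) :=
          occ_run_le_occ_output A b S hl hlk hβ _ hwlen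
      _ ≤ occ (v k) (factor A s k) := by
          rw [hout k]
          exact occ_initSeg_mono x (by omega) _ hwlen
      _ = N k (window k A s) := by rw [← hfac]
  have hNsum : ∀ k, 1 ≤ k → ((∑ w, N k w : ℕ) : ℝ) ≤ lam * (b : ℝ) ^ k := by
    intro k hk
    refine le_trans (Nat.cast_le.2 ?_) (Nat.floor_le (by positivity : 0 ≤ lam * (b : ℝ) ^ k))
    refine (sum_occ_le (v k) k).trans ?_
    simp only [v, initSeg_length]
    omega
  have hcard : ∀ k, (Fintype.card (Fin k → Ω) : ℝ) = (b : ℝ) ^ k := by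
    intro k; simp [hbdef]
  have hq : ∀ j, 1 ≤ j → Tendsto (fun k => q k j) atTop (𝓝 (p j)) := fun j hj =>
    tendsto_card_startSet_div hb hp hp1 hS hj
  have hqU : ∀ k, 1 ≤ k → ∀ j, ((U k j).card : ℝ) = q k j * (b : ℝ) ^ k := by
    intro k hk j
    simp only [q]
    rw [hUcard k hk, div_mul_cancel₀ _ (by positivity)]
  -- The error bound, relative to `b ^ k`, when the multiplicities below `M` are taken into account.
  let e : ℕ → ℕ → ℝ := fun M k => lam - ∑ j ∈ Finset.Ico 1 M, (j : ℝ) * q k j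
  have he : ∀ M, Tendsto (e M) atTop (𝓝 (lam - ∑ j ∈ Finset.Ico 1 M, (j : ℝ) * p j)) := by
    intro M
    refine tendsto_const_nhds.sub (tendsto_finsetSum _ fun j hj => ?_)
    exact (hq j (Finset.mem_Ico.1 hj).1).const_mul _
  have he' : Tendsto (fun M : ℕ => lam - ∑ j ∈ Finset.Ico 1 M, (j : ℝ) * p j) atTop (𝓝 0) := by
    have h3 := hmean.tendsto_sum_nat.const_sub lam
    rw [sub_self] at h3
    refine h3.congr' ?_
    filter_upwards [eventually_ge_atTop 1] with M hM
    rw [Finset.range_eq_Ico, Finset.sum_eq_sum_Ico_succ_bot (by omega)]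
    simp
  have hdiv : ∀ M k : ℕ, 1 ≤ k → ∀ y B : ℝ,
      |y - B * (b : ℝ) ^ k| ≤
        (∑ w, N k w : ℕ) - ∑ j ∈ Finset.Ico 1 M, (j : ℝ) * (U k j).card →
      |y / (b : ℝ) ^ k - B| ≤ e M k := by
    intro M k hk y B hy
    have hbk : (0 : ℝ) < (b : ℝ) ^ k := by positivity
    have h3 : y / (b : ℝ) ^ k - B = (y - B * (b : ℝ) ^ k) / (b : ℝ) ^ k := by
      field_simp
    rw [h3, abs_div, abs_of_pos hbk, div_le_iff₀ hbk]
    refine hy.trans ?_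
    simp only [e]
    rw [sub_mul, Finset.sum_mul]
    refine sub_le_sub (hNsum k hk) (le_of_eq (Finset.sum_congr rfl fun j _ => ?_))
    rw [hqU k hk, mul_assoc]
  have hmain := fun M k (hk : 1 ≤ k) => abs_card_sub_le_excess (N k) (U k) M
    (fun i _ j _ => hUdisj k hk i j) (fun j _ => hNge k hk j)
  rcases Nat.eq_zero_or_pos i with rfl | hi
  · refine tendsto_of_approx (t := fun M k => 1 - ∑ j ∈ Finset.Ico 1 M, q k j) (e := e)
      (t' := fun M => 1 - ∑ j ∈ Finset.Ico 1 M, p j) (Eventually.of_forall fun M => ?_)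
      (Eventually.of_forall fun M => ?_) he ?_ he'
    · filter_upwards [eventually_ge_atTop 1] with k hk
      refine hdiv M k hk _ _ (le_trans (le_of_eq ?_) (hmain M k hk).2)
      rw [hcard, sub_mul, one_mul, Finset.sum_mul]
      simp only [hqU k hk]
      rfl
    · exact tendsto_const_nhds.sub
        (tendsto_finsetSum _ fun j hj => hq j (Finset.mem_Ico.1 hj).1)
    · have h3 := (hsum.tendsto_sum_nat.const_sub 1).add_const (p 0)
      rw [sub_self, zero_add] at h3
      refine h3.congr' ?_
      filter_upwards [eventually_ge_atTop 1] with M hM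
      rw [Finset.range_eq_Ico, Finset.sum_eq_sum_Ico_succ_bot (by omega)]
      simp only [zero_add]
      ring
  · refine tendsto_of_approx (t := fun _ k => q k i) (e := e) (t' := fun _ => p i) ?_
      (Eventually.of_forall fun M => hq i hi) he tendsto_const_nhds he'
    filter_upwards [eventually_gt_atTop i] with M hM
    filter_upwards [eventually_ge_atTop 1] with k hk
    refine hdiv M k hk _ _ (le_trans (le_of_eq ?_)
      ((hmain M k hk).1 i (Finset.mem_Ico.2 ⟨hi, hM⟩)))
    rw [hqU k hk]

end PoissonGeneric

theorem theorem1 {Ω : Type*} [Fintype Ω] [DecidableEq Ω] (hb : 2 ≤ Fintype.card Ω)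
    (lam : ℝ) (hlam : 0 < lam) (p : ℕ → ℝ) (hp : ∀ i, 0 ≤ p i)
    (hsum : HasSum p 1) (hmean : HasSum (fun i : ℕ => (i : ℝ) * p i) lam)
    (h2 : Fintype.card Ω = 2 → 1 / 2 ≤ p 0) :
    (∃ A : ℕ → Ω, PoissonGeneric.IsInfiniteDeBruijn A) ∧
    ∀ A : ℕ → Ω, PoissonGeneric.IsInfiniteDeBruijn A →
      (∃ x : ℕ → Ω, PoissonGeneric.IsConstructed p A x) ∧
      ∀ x : ℕ → Ω, PoissonGeneric.IsConstructed p A x →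
        ∀ i : ℕ, Filter.Tendsto (fun k : ℕ => PoissonGeneric.Z lam i k x) Filter.atTop
          (nhds (p i)) :=
  ⟨PoissonGeneric.exists_isInfiniteDeBruijn hb, fun A hA =>
    ⟨PoissonGeneric.exists_isConstructed hb hlam hp hsum hmean A, fun _ hx i =>
      PoissonGeneric.tendsto_Z hb hlam hp hsum hmean h2 hA hx i⟩⟩
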